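/- Let $k$ be a field of characteristic $0$ and let $\Gamma$ be an acyclic perfect planar network on a disk with $N$ sources and $N$ sinks: a finite acyclic directed graph embedded in the disk whose boundary vertices are univalent ($N$ sources, all on the left, and $N$ sinks, all on the right, each labelled $1,\dots,N$ from top to bottom), and whose internal vertices are trivalent and neither sources nor sinks. An internal vertex is white if it has one incoming edge and black if it has one outgoing edge. Glue the $i$-th sink to the $i$-th source for every $i$, and let $\mathcal C$ be the $k$-linear category of directed paths of the glued graph that start and end at the $N$ marked points; composition is concatenation of paths, $fg$ meaning first $f$, then $g$. The boundary measurement matrix $B=(b_{ij})$ has as entry $b_{ij}\in\mathrm{Hom}_{\mathcal C}(i,j)$ the sum of all directed paths of $\Gamma$ from source $i$ to sink $j$. Assume that for every $i$ there is a directed path in $\Gamma$ from source $i$ to sink $i$. The double bracket $\{\!\!\{\cdot,\cdot\}\!\!\}:\mathrm{Hom}(a,b)\otimes\mathrm{Hom}(c,d)\to\mathrm{Hom}(c,b)\otimes\mathrm{Hom}(a,d)$ on paths is the skew-symmetric biderivation, that is, $$\{\!\!\{f,g\}\!\!\}=-\{\!\!\{g,f\}\!\!\}^{\tau},\quad \{\!\!\{fg,h\}\!\!\}=(1\otimes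 f)\{\!\!\{g,h\}\!\!\}+\{\!\!\{f,h\}\!\!\}(g\otimes 1),\quad \{\!\!\{f,gh\}\!\!\}=(g\otimes 1)\{\!\!\{f,h\}\!\!\}+\{\!\!\{f,g\}\!\!\}(1\otimes h),$$ whose value on two edges is the sum of the following contributions of internal vertices: $\{\!\!\{x_1,x_2\}\!\!\}=\frac12\,x_1\otimes x_2$ at a white vertex with outgoing edges $x_1,x_2$ and incoming edge $x_3$ in counterclockwise order $x_1,x_2,x_3$; $\{\!\!\{y_1,y_2\}\!\!\}=-\frac12\,y_2\otimes y_1$ at a black vertex with incoming edges $y_1,y_2$ and outgoing edge $y_3$ in counterclockwise order $y_1,y_2,y_3$; all other contributions (up to skew-symmetry) are zero. Let $\mathcal C_\natural=\big(\bigoplus_i\mathrm{Hom}_{\mathcal C}(i,i)\big)/[\mathcal C,\mathcal C]$ be the cyclic space, $\overline f$ the class of a loop $f$, and $\{\overline f,g\}=\mu\,\{\!\!\{f,g\}\!\!\}$ the induced bracket $\mathcal C_\natural\otimes\mathcal C\to\mathcal C$, where $\mu$ is concatenation. Put $X=B-\mathbf 1$, let $\mathcal C_{(m)}$ be the span of the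 composable monomials of length $m$ in the entries of $X$, and let $\widehat{\mathcal C}=\prod_{m\ge0}\mathcal C_{(m)}$, $\widehat{\mathcal C}_\natural=\prod_{m\ge0}(\mathcal C_\natural)_{(m)}$ be the spaces of formal power series, where $(\mathcal C_\natural)_{(m)}$ is the image of the loops in $\mathcal C_{(m)}$. The bracket is extended to $\{\cdot,\cdot\}:\widehat{\mathcal C}_\natural\otimes\widehat{\mathcal C}\to\widehat{\mathcal C}$ by continuity, modulo terms of degree $\ge D$ for every $D$. Let $$\log B=\sum_{n\ge1}\frac{(-1)^{n+1}}{n}(B-\mathbf 1)^n,\qquad H=\frac12\,\overline{\mathrm{tr}\,(\log B)^2}\in\widehat{\mathcal C}_\natural .$$ Then for all $i,j$ the bracket $\{H,b_{ij}\}$ exists and is uniquely determined in $\widehat{\mathcal C}$, and $$\{H,B\}=MB-BM,\qquad M_{ij}=\begin{cases}\ \ \tfrac12(\log B)_{ij},& i<j,\\ \ \ 0,& i=j,\\ -\tfrac12(\log B)_{ij},& i>j.\end{cases}$$ -/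

import Mathlib

open scoped TensorProduct DirectSum

/-! ### Networks on a disk -/

/-- The vertices of a directed graph in a disk with internal vertex set `V`, with `N` sources and
`N` sinks on the boundary. -/
inductive NetVertex (V : Type) (N : ℕ) : Type
  | internal : V → NetVertex V N
  | source : Fin N → NetVertex V N
  | sink : Fin N → NetVertex V N

/-- The vertex to which a half-edge is attached. An edge `e` has two half-edges: `Sum.inl e` at its
tail and `Sum.inr e` at its head. -/
def halfEdgeVertex {V E : Type} {N : ℕ} (src tgt : E → NetVertex V N) : E ⊕ E → NetVertex V N :=
  Sum.elim src tgt

/-- An acyclic perfect planar network with `N` sources and `N` sinks on the boundary of the disk,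
sources and sinks being separated: it is a finite directed graph (multiple edges are allowed)
embedded in a disk, up to isotopy.

The embedding is recorded combinatorially, by a rotation system. Collapsing the boundary circle of
the disk to one point `∞` turns the disk into an oriented sphere, and the network into a graph on
the sphere with vertex set `V ∪ {∞}`. The permutation `rot` sends each half-edge to the next one in
the counterclockwise order around its end point. Around `∞` this is the clockwise order along the
boundary of the disk; sources are labelled counterclockwise and sinks clockwise, so that the indices
increase from top to bottom on either side. The orbits of "exchange the two halves of the edge, then
rotate" are the faces, and the embedding is planar iff Euler's formula holds. (The graph on the
sphere is connected: by finiteness, acyclicity, and the absence of internal sinks, every internal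
vertex is joined to `∞`.) -/
structure DiskNetwork (N : ℕ) where
  /-- internal vertices -/
  V : Type
  /-- edges -/
  E : Type
  [finiteV : Finite V]
  [finiteE : Finite E]
  /-- tail of an edge -/
  src : E → NetVertex V N
  /-- head of an edge -/
  tgt : E → NetVertex V N
  /-- the edge which starts at a given source -/
  sourceEdge : Fin N → E
  /-- the edge which ends at a given sink -/
  sinkEdge : Fin N → E
  /-- the boundary sources are univalent, with an outgoing edge -/
  source_univalent : ∀ (i : Fin N) (d : E ⊕ E),
    halfEdgeVertex src tgt d = .source i ↔ d = Sum.inl (sourceEdge i)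
  /-- the boundary sinks are univalent, with an incoming edge -/
  sink_univalent : ∀ (i : Fin N) (d : E ⊕ E),
    halfEdgeVertex src tgt d = .sink i ↔ d = Sum.inr (sinkEdge i)
  /-- internal vertices are trivalent -/
  trivalent : ∀ v : V, Nat.card {d : E ⊕ E // halfEdgeVertex src tgt d = .internal v} = 3
  /-- internal vertices are not sources -/
  not_source : ∀ v : V, ∃ e, tgt e = .internal v
  /-- internal vertices are not sinks -/
  not_sink : ∀ v : V, ∃ e, src e = .internal v
  /-- there are no directed cycles -/
  acyclic : ∀ a : NetVertex V N, ¬ Relation.TransGen (fun x y => ∃ e, src e = x ∧ tgt e = y) a a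
  /-- the rotation system -/
  rot : Equiv.Perm (E ⊕ E)
  /-- at an internal vertex, `rot` permutes the half-edges at this vertex ... -/
  rot_vertex : ∀ (v : V) (d : E ⊕ E), halfEdgeVertex src tgt d = .internal v →
    halfEdgeVertex src tgt (rot d) = .internal v
  /-- ... cyclically -/
  rot_cyclic : ∀ (v : V) (d d' : E ⊕ E), halfEdgeVertex src tgt d = .internal v →
    halfEdgeVertex src tgt d' = .internal v → rot.SameCycle d d'
  /-- on the boundary: going up the sources, from the first source to the first sink, going down
  the sinks, and from the last sink to the last source -/
  rot_source : ∀ i j : Fin N, (i : ℕ) + 1 = j →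
    rot (Sum.inl (sourceEdge j)) = Sum.inl (sourceEdge i)
  rot_first : ∀ i : Fin N, (i : ℕ) = 0 → rot (Sum.inl (sourceEdge i)) = Sum.inr (sinkEdge i)
  rot_sink : ∀ i j : Fin N, (i : ℕ) + 1 = j →
    rot (Sum.inr (sinkEdge i)) = Sum.inr (sinkEdge j)
  rot_last : ∀ i : Fin N, (i : ℕ) + 1 = N →
    rot (Sum.inr (sinkEdge i)) = Sum.inl (sourceEdge i)
  /-- Euler's formula on the sphere; there are no networks with `N = 0` -/
  euler : (Nat.card V + 1) +
      Nat.card (Quotient (Equiv.Perm.SameCycle.setoid ((Equiv.sumComm E E).trans rot)))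
    = Nat.card E + 2

namespace DiskNetwork

attribute [instance] DiskNetwork.finiteV DiskNetwork.finiteE

variable {N : ℕ} (Γ : DiskNetwork N)

/-- The vertices of the network, as a quiver. -/
def Vertex : Type := NetVertex Γ.V N

instance : Quiver Γ.Vertex := ⟨fun a b => {e : Γ.E // Γ.src e = a ∧ Γ.tgt e = b}⟩

/-- The `i`-th source. -/
def source (i : Fin N) : Γ.Vertex := NetVertex.source i

/-- The `i`-th sink. -/
def sink (i : Fin N) : Γ.Vertex := NetVertex.sink i

/-- The vertices of the network obtained by gluing the `i`-th sink to the `i`-th source for all `i`: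
internal vertices, and `N` marked points. -/
def Glued : Type := Γ.V ⊕ Fin N

/-- The gluing map on vertices. -/
def glueVertex : NetVertex Γ.V N → Γ.Glued
  | .internal v => Sum.inl v
  | .source i => Sum.inr i
  | .sink i => Sum.inr i

instance : Quiver Γ.Glued :=
  ⟨fun a b => {e : Γ.E // Γ.glueVertex (Γ.src e) = a ∧ Γ.glueVertex (Γ.tgt e) = b}⟩

/-- The gluing map from the network to the glued network. -/
def glue : Γ.Vertex ⥤q Γ.Glued where
  obj := Γ.glueVertex
  map e := ⟨e.1, congrArg Γ.glueVertex e.2.1, congrArg Γ.glueVertex e.2.2⟩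

/-- The `i`-th marked point. -/
def pt (i : Fin N) : Γ.Glued := Sum.inr i

/-- A network has finitely many paths between two given vertices. -/
instance finite_path (a b : Γ.Vertex) : Finite (Quiver.Path a b) := by
  let R : NetVertex Γ.V N → NetVertex Γ.V N → Prop := fun x y => ∃ e, Γ.src e = x ∧ Γ.tgt e = y
  have hfin : Finite (NetVertex Γ.V N) := by
    let f : NetVertex Γ.V N → Γ.V ⊕ (Fin N ⊕ Fin N) := fun x => match x with
      | .internal v => Sum.inl v
      | .source i => Sum.inr (Sum.inl i)
      | .sink i => Sum.inr (Sum.inr i)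
    refine Finite.of_injective f ?_
    intro x y h
    cases x <;> cases y <;> simp_all [f]
  have hwf : WellFounded (Relation.TransGen R) :=
    haveI : Std.Irrefl (Relation.TransGen R) := ⟨Γ.acyclic⟩
    Finite.wellFounded_of_trans_of_irrefl _
  induction b using hwf.induction with
  | _ b ih =>
    have : ∀ e : {e : Γ.E // Γ.tgt e = b},
        Finite (@Quiver.Path Γ.Vertex _ a (Γ.src e.1)) :=
      fun e => ih _ (Relation.TransGen.single ⟨e.1, rfl, e.2⟩)
    let F : Option (Σ e : {e : Γ.E // Γ.tgt e = b}, @Quiver.Path Γ.Vertex _ a (Γ.src e.1)) →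
        Set (@Quiver.Path Γ.Vertex _ a b) := fun x => match x with
      | none => {p | p.length = 0}
      | some ⟨e, p⟩ => {@Quiver.Path.cons Γ.Vertex _ a (Γ.src e.1) b p ⟨e.1, rfl, e.2⟩}
    have hF : ∀ x, (F x).Finite := by
      rintro (_ | ⟨e, p⟩)
      · refine Set.Subsingleton.finite ?_
        intro p hp q hq
        have h := Quiver.Path.eq_of_length_zero p hp
        subst h
        rw [Quiver.Path.eq_nil_of_length_zero p hp, Quiver.Path.eq_nil_of_length_zero q hq]
      · exact Set.finite_singleton _
    refine Set.finite_univ_iff.mp ((Set.finite_iUnion hF).subset ?_)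
    intro p _
    refine Set.mem_iUnion.mpr ?_
    cases p with
    | nil => exact ⟨none, rfl⟩
    | @cons c _ p e =>
      obtain ⟨e, rfl, he⟩ := e
      exact ⟨some ⟨⟨e, he⟩, p⟩, rfl⟩

noncomputable section

open Classical in
/-- The paths in the network from `a` to `b`. -/
instance fintypePath (a b : Γ.Vertex) : Fintype (Quiver.Path a b) := Fintype.ofFinite _

variable (k : Type*) [Field k]

/-! ### The `k`-linear category of paths and its double bracket -/

/-- The morphisms `a → b` in the `k`-linear category of paths of the glued network: formal linear
combinations of paths. The category `𝓒` of paths which start and end at marked points is the full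
subcategory on the objects `pt i`. -/
def Mor (a b : Γ.Glued) : Type _ := Quiver.Path a b →₀ k

instance (a b : Γ.Glued) : AddCommGroup (Γ.Mor k a b) :=
  inferInstanceAs (AddCommGroup (Quiver.Path a b →₀ k))

instance (a b : Γ.Glued) : Module k (Γ.Mor k a b) :=
  inferInstanceAs (Module k (Quiver.Path a b →₀ k))

variable {Γ k}

/-- A path, as a morphism. -/
def ofPath {a b : Γ.Glued} (p : Quiver.Path a b) : Γ.Mor k a b := Finsupp.single p 1

/-- An edge, as a morphism. -/
abbrev ofEdge {a b : Γ.Glued} (e : a ⟶ b) : Γ.Mor k a b := ofPath e.toPath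

/-- Paths form a basis: linear extension of a function on paths. -/
def extend {a b : Γ.Glued} {M : Type*} [AddCommMonoid M] [Module k M]
    (φ : Quiver.Path a b → M) : Γ.Mor k a b →ₗ[k] M :=
  Finsupp.linearCombination k φ

theorem extend_ofPath {a b : Γ.Glued} {M : Type*} [AddCommMonoid M] [Module k M]
    (φ : Quiver.Path a b → M) (p : Quiver.Path a b) :
    extend φ (ofPath p : Γ.Mor k a b) = φ p :=
  (Finsupp.linearCombination_single k (1 : k) p).trans (one_smul k _)

theorem mor_induction {a b : Γ.Glued} {P : Γ.Mor k a b → Prop} (f : Γ.Mor k a b) (zero : P 0)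
    (add : ∀ f g, P f → P g → P (f + g)) (smul : ∀ (r : k) f, P f → P (r • f))
    (path : ∀ p, P (ofPath p)) : P f := by
  refine Finsupp.induction_linear (motive := P) f zero add fun p r => ?_
  have h : (Finsupp.single p r : Quiver.Path a b →₀ k) = r • Finsupp.single p 1 := by simp
  rw [h]
  exact smul r _ (path p)

/-- Concatenation of (linear combinations of) paths: `conc f g` is "first `f`, then `g`". -/
def conc {a b c : Γ.Glued} : Γ.Mor k a b →ₗ[k] Γ.Mor k b c →ₗ[k] Γ.Mor k a c :=
  extend fun p => extend fun q => ofPath (p.comp q)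

/-- `(f ⊗ 1) T` -/
def mulL1 {a a' b c d : Γ.Glued} (f : Γ.Mor k a a') :
    Γ.Mor k a' b ⊗[k] Γ.Mor k c d →ₗ[k] Γ.Mor k a b ⊗[k] Γ.Mor k c d :=
  LinearMap.rTensor _ (conc f)

/-- `(1 ⊗ f) T` -/
def mulL2 {a b c c' d : Γ.Glued} (f : Γ.Mor k c c') :
    Γ.Mor k a b ⊗[k] Γ.Mor k c' d →ₗ[k] Γ.Mor k a b ⊗[k] Γ.Mor k c d :=
  LinearMap.lTensor _ (conc f)

/-- `T (f ⊗ 1)` -/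
def mulR1 {a b b' c d : Γ.Glued} (f : Γ.Mor k b' b) :
    Γ.Mor k a b' ⊗[k] Γ.Mor k c d →ₗ[k] Γ.Mor k a b ⊗[k] Γ.Mor k c d :=
  LinearMap.rTensor _ (conc.flip f)

/-- `T (1 ⊗ f)` -/
def mulR2 {a b c d d' : Γ.Glued} (f : Γ.Mor k d' d) :
    Γ.Mor k a b ⊗[k] Γ.Mor k c d' →ₗ[k] Γ.Mor k a b ⊗[k] Γ.Mor k c d :=
  LinearMap.lTensor _ (conc.flip f)

variable (Γ) in
open Classical in
/-- `1/2` if `e`, `e'` are the outgoing edges of a white vertex (one incoming, two outgoing edges),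
and `e, e'`, incoming edge, is their counterclockwise order; `-1/2` if `e', e`, incoming edge, is
this order; `0` otherwise. -/
def whiteCoeff (k : Type*) [Field k] (e e' : Γ.E) : k :=
  if ∃ v : Γ.V, Γ.src e = .internal v ∧ Γ.src e' = .internal v then
    (if Γ.rot (Sum.inl e) = Sum.inl e' then 1 / 2 else 0) -
      (if Γ.rot (Sum.inl e') = Sum.inl e then 1 / 2 else 0)
  else 0

variable (Γ) in
open Classical in
/-- `-1/2` if `e`, `e'` are the incoming edges of a black vertex (two incoming, one outgoing edge),
and `e, e'`, outgoing edge, is their counterclockwise order; `1/2` if `e', e`, outgoing edge, is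
this order; `0` otherwise. -/
def blackCoeff (k : Type*) [Field k] (e e' : Γ.E) : k :=
  if ∃ v : Γ.V, Γ.tgt e = .internal v ∧ Γ.tgt e' = .internal v then
    (if Γ.rot (Sum.inr e') = Sum.inr e then 1 / 2 else 0) -
      (if Γ.rot (Sum.inr e) = Sum.inr e' then 1 / 2 else 0)
  else 0

open Classical in
/-- The double bracket of two edges: `(1/2) x₁ ⊗ x₂` for the outgoing edges `x₁, x₂` of a white
vertex in counterclockwise order, `-(1/2) y₂ ⊗ y₁` for the incoming edges `y₁, y₂` of a black vertex
in counterclockwise order, extended by skew-symmetry, added up over all internal vertices. -/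
def edgeBracket {a b c d : Γ.Glued} (e : a ⟶ b) (e' : c ⟶ d) : Γ.Mor k c b ⊗[k] Γ.Mor k a d :=
  (if h : a = c then
    Γ.whiteCoeff k e.1 e'.1 •
      ((ofEdge ⟨e.1, e.2.1.trans h, e.2.2⟩ : Γ.Mor k c b) ⊗ₜ[k]
        (ofEdge ⟨e'.1, e'.2.1.trans h.symm, e'.2.2⟩ : Γ.Mor k a d))
  else 0) +
  (if h : b = d then
    Γ.blackCoeff k e.1 e'.1 •
      ((ofEdge ⟨e'.1, e'.2.1, e'.2.2.trans h.symm⟩ : Γ.Mor k c b) ⊗ₜ[k]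
        (ofEdge ⟨e.1, e.2.1, e.2.2.trans h⟩ : Γ.Mor k a d))
  else 0)

/-- The double bracket of a path and an edge, by the Leibniz identity
`⦃f e, e'⦄ = (1 ⊗ f) ⦃e, e'⦄ + ⦃f, e'⦄ (e ⊗ 1)`. -/
def pathEdgeBracket {a c d : Γ.Glued} (e' : c ⟶ d) :
    ∀ {b : Γ.Glued}, Quiver.Path a b → Γ.Mor k c b ⊗[k] Γ.Mor k a d
  | _, .nil => 0
  | _, .cons f e =>
      mulL2 (ofPath f) (edgeBracket e e') + mulR1 (ofEdge e) (pathEdgeBracket e' f)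

/-- The double bracket of two paths, by the Leibniz identity
`⦃f, g e'⦄ = (g ⊗ 1) ⦃f, e'⦄ + ⦃f, g⦄ (1 ⊗ e')`. -/
def pathBracket {a b c : Γ.Glued} (f : Quiver.Path a b) :
    ∀ {d : Γ.Glued}, Quiver.Path c d → Γ.Mor k c b ⊗[k] Γ.Mor k a d
  | _, .nil => 0
  | _, .cons g e' =>
      mulL1 (ofPath g) (pathEdgeBracket e' f) + mulR2 (ofEdge e') (pathBracket f g)

/-- The double bracket `⦃ , ⦄ : Hom(a,b) ⊗ Hom(c,d) → Hom(c,b) ⊗ Hom(a,d)`. -/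
def dbracket {a b c d : Γ.Glued} :
    Γ.Mor k a b →ₗ[k] Γ.Mor k c d →ₗ[k] Γ.Mor k c b ⊗[k] Γ.Mor k a d :=
  extend fun f => extend fun g => pathBracket f g

/-- The concatenation map `μ : Hom(a,b) ⊗ Hom(b,c) → Hom(a,c)`. -/
def mu {a b c : Γ.Glued} : Γ.Mor k a b ⊗[k] Γ.Mor k b c →ₗ[k] Γ.Mor k a c :=
  TensorProduct.lift conc

/-! Elementary identities, needed for the bracket to be well defined on the cyclic space. -/

theorem ofPath_comp {a b c : Γ.Glued} (p : Quiver.Path a b) (q : Quiver.Path b c) :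
    (ofPath (p.comp q) : Γ.Mor k a c) = conc (ofPath p) (ofPath q) := by
  rw [conc, extend_ofPath, extend_ofPath]

theorem ofPath_cons {a b c : Γ.Glued} (p : Quiver.Path a b) (e : b ⟶ c) :
    (ofPath (p.cons e) : Γ.Mor k a c) = conc (ofPath p) (ofEdge e) := by
  rw [← ofPath_comp, Quiver.Path.comp_toPath_eq_cons]

theorem conc_assoc {a b c d : Γ.Glued} (f : Γ.Mor k a b) (g : Γ.Mor k b c) (h : Γ.Mor k c d) :
    conc (conc f g) h = conc f (conc g h) := by
  induction f using mor_induction with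
  | zero => simp only [map_zero, LinearMap.zero_apply]
  | add f f' hf hf' => simp only [map_add, LinearMap.add_apply, hf, hf']
  | smul r f hf => simp only [map_smul, LinearMap.smul_apply, hf]
  | path p =>
    induction g using mor_induction with
    | zero => simp only [map_zero, LinearMap.zero_apply]
    | add f f' hf hf' => simp only [map_add, LinearMap.add_apply, hf, hf']
    | smul r f hf => simp only [map_smul, LinearMap.smul_apply, hf]
    | path q =>
      induction h using mor_induction with
      | zero => simp only [map_zero]
      | add f f' hf hf' => simp only [map_add, hf, hf']
      | smul r f hf => simp only [map_smul, hf]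
      | path u => simp only [← ofPath_comp, Quiver.Path.comp_assoc]

theorem conc_nil {a b : Γ.Glued} (f : Γ.Mor k a b) :
    conc f (ofPath (Quiver.Path.nil : Quiver.Path b b)) = f := by
  induction f using mor_induction with
  | zero => simp only [map_zero, LinearMap.zero_apply]
  | add f f' hf hf' => simp only [map_add, LinearMap.add_apply, hf, hf']
  | smul r f hf => simp only [map_smul, LinearMap.smul_apply, hf]
  | path p => rw [← ofPath_comp, Quiver.Path.comp_nil]

theorem nil_conc {a b : Γ.Glued} (f : Γ.Mor k a b) :
    conc (ofPath (Quiver.Path.nil : Quiver.Path a a)) f = f := by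
  induction f using mor_induction with
  | zero => simp only [map_zero]
  | add f f' hf hf' => simp only [map_add, hf, hf']
  | smul r f hf => simp only [map_smul, hf]
  | path p => rw [← ofPath_comp, Quiver.Path.nil_comp]

theorem pathEdgeBracket_comp {a b b' c d : Γ.Glued} (p : Quiver.Path a b) (q : Quiver.Path b b')
    (e : c ⟶ d) : (pathEdgeBracket e (p.comp q) : Γ.Mor k c b' ⊗[k] Γ.Mor k a d) =
      mulL2 (ofPath p) (pathEdgeBracket e q) + mulR1 (ofPath q) (pathEdgeBracket e p) := by
  induction q with
  | nil =>
    have : ∀ T : Γ.Mor k c b ⊗[k] Γ.Mor k a d, mulR1 (ofPath (Quiver.Path.nil)) T = T := by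
      intro T
      induction T with
      | zero => simp
      | add x y hx hy => rw [map_add, hx, hy]
      | tmul x y => simp only [mulR1, LinearMap.rTensor_tmul, LinearMap.flip_apply, conc_nil]
    rw [this]
    simp [pathEdgeBracket]
  | cons q e' ih =>
    rw [Quiver.Path.comp_cons, pathEdgeBracket, ih, pathEdgeBracket, map_add, map_add, ← add_assoc]
    congr 1
    · congr 1
      · induction (edgeBracket e' e : Γ.Mor k _ _ ⊗[k] Γ.Mor k _ _) with
        | zero => simp
        | add x y hx hy => simp only [map_add, hx, hy]
        | tmul x y => simp only [mulL2, LinearMap.lTensor_tmul, ofPath_comp, conc_assoc]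
      · induction (pathEdgeBracket e q : Γ.Mor k _ _ ⊗[k] Γ.Mor k _ _) with
        | zero => simp
        | add x y hx hy => simp only [map_add, hx, hy]
        | tmul x y => simp only [mulL2, mulR1, LinearMap.lTensor_tmul, LinearMap.rTensor_tmul]
    · induction (pathEdgeBracket e p : Γ.Mor k _ _ ⊗[k] Γ.Mor k _ _) with
      | zero => simp
      | add x y hx hy => simp only [map_add, hx, hy]
      | tmul x y =>
        simp only [mulR1, LinearMap.rTensor_tmul, ofPath_cons, LinearMap.flip_apply, conc_assoc]

theorem pathBracket_comp {a b b' c d : Γ.Glued} (p : Quiver.Path a b) (q : Quiver.Path b b')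
    (r : Quiver.Path c d) : (pathBracket (p.comp q) r : Γ.Mor k c b' ⊗[k] Γ.Mor k a d) =
      mulL2 (ofPath p) (pathBracket q r) + mulR1 (ofPath q) (pathBracket p r) := by
  induction r with
  | nil => simp [pathBracket]
  | cons r e ih =>
    simp only [pathBracket]
    rw [pathEdgeBracket_comp, ih, map_add, map_add, map_add, map_add, add_add_add_comm]
    congr 1
    · congr 1
      · induction (pathEdgeBracket e q : Γ.Mor k _ _ ⊗[k] Γ.Mor k _ _) with
        | zero => simp
        | add x y hx hy => simp only [map_add, hx, hy]
        | tmul x y => simp only [mulL1, mulL2, LinearMap.lTensor_tmul, LinearMap.rTensor_tmul]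
      · induction (pathBracket q r : Γ.Mor k _ _ ⊗[k] Γ.Mor k _ _) with
        | zero => simp
        | add x y hx hy => simp only [map_add, hx, hy]
        | tmul x y =>
          simp only [mulR2, mulL2, LinearMap.lTensor_tmul, LinearMap.flip_apply, conc_assoc]
    · congr 1
      · induction (pathEdgeBracket e p : Γ.Mor k _ _ ⊗[k] Γ.Mor k _ _) with
        | zero => simp
        | add x y hx hy => simp only [map_add, hx, hy]
        | tmul x y =>
          simp only [mulL1, mulR1, LinearMap.rTensor_tmul, LinearMap.flip_apply, conc_assoc]
      · induction (pathBracket p r : Γ.Mor k _ _ ⊗[k] Γ.Mor k _ _) with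
        | zero => simp
        | add x y hx hy => simp only [map_add, hx, hy]
        | tmul x y => simp only [mulR2, mulR1, LinearMap.lTensor_tmul, LinearMap.rTensor_tmul]

theorem dbracket_ofPath {a b c d : Γ.Glued} (p : Quiver.Path a b) (q : Quiver.Path c d) :
    dbracket (ofPath p : Γ.Mor k a b) (ofPath q : Γ.Mor k c d) = pathBracket p q := by
  rw [dbracket, extend_ofPath, extend_ofPath]

theorem mu_mulL2 {a b c d : Γ.Glued} (f : Γ.Mor k b c) (T : Γ.Mor k a b ⊗[k] Γ.Mor k c d) :
    mu (mulL2 f T) = mu (mulR1 f T) := by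
  induction T with
  | zero => simp
  | add x y hx hy => simp only [map_add, hx, hy]
  | tmul x y =>
    simp only [mu, mulL2, mulR1, LinearMap.lTensor_tmul, LinearMap.rTensor_tmul,
      TensorProduct.lift.tmul, LinearMap.flip_apply, conc_assoc]

theorem mu_dbracket_comm {a b c d : Γ.Glued} (f : Γ.Mor k a b) (g : Γ.Mor k b a)
    (h : Γ.Mor k c d) : mu (dbracket (conc f g) h) = mu (dbracket (conc g f) h) := by
  induction f using mor_induction with
  | zero => simp only [map_zero, LinearMap.zero_apply]
  | add f f' hf hf' => simp only [map_add, LinearMap.add_apply, hf, hf']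
  | smul r f hf => simp only [map_smul, LinearMap.smul_apply, hf]
  | path p =>
    induction g using mor_induction with
    | zero => simp only [map_zero, LinearMap.zero_apply]
    | add f f' hf hf' => simp only [map_add, LinearMap.add_apply, hf, hf']
    | smul r f hf => simp only [map_smul, LinearMap.smul_apply, hf]
    | path q =>
      induction h using mor_induction with
      | zero => simp only [map_zero]
      | add f f' hf hf' => simp only [map_add, hf, hf']
      | smul r f hf => simp only [map_smul, hf]
      | path u =>
        rw [← ofPath_comp, ← ofPath_comp, dbracket_ofPath, dbracket_ofPath, pathBracket_comp,
          pathBracket_comp, map_add, map_add, mu_mulL2, mu_mulL2, add_comm]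

/-! ### The cyclic space and the induced bracket -/

variable (Γ k) in
/-- The direct sum of the spaces of loops of `𝓒`. -/
abbrev Loops : Type _ := ∀ i : Fin N, Γ.Mor k (Γ.pt i) (Γ.pt i)

variable (Γ k) in
/-- The span of the commutators `fg - gf`, where `fg` is a loop of `𝓒`. -/
def commutators : Submodule k (Γ.Loops k) :=
  Submodule.span k {x | ∃ (i j : Fin N) (f : Γ.Mor k (Γ.pt i) (Γ.pt j))
    (g : Γ.Mor k (Γ.pt j) (Γ.pt i)), x = Pi.single i (conc f g) - Pi.single j (conc g f)}

variable (Γ k) in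
/-- The cyclic space `𝓒_♮`: loops modulo commutators. -/
abbrev Cyc : Type _ := Γ.Loops k ⧸ Γ.commutators k

/-- The class of a loop in the cyclic space. -/
def toCyc (i : Fin N) : Γ.Mor k (Γ.pt i) (Γ.pt i) →ₗ[k] Γ.Cyc k :=
  (Γ.commutators k).mkQ ∘ₗ LinearMap.single k (fun i => Γ.Mor k (Γ.pt i) (Γ.pt i)) i

/-- `f ↦ μ ⦃f, g⦄`, on the direct sum of the spaces of loops. -/
def loopBracket {c d : Γ.Glued} : Γ.Loops k →ₗ[k] Γ.Mor k c d →ₗ[k] Γ.Mor k c d :=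
  LinearMap.lsum k (fun i => Γ.Mor k (Γ.pt i) (Γ.pt i)) k fun _ => dbracket.compr₂ mu

theorem commutators_le_ker (c d : Γ.Glued) :
    Γ.commutators k ≤ LinearMap.ker (loopBracket (k := k) (c := c) (d := d)) := by
  refine Submodule.span_le.mpr ?_
  rintro _ ⟨i, j, f, g, rfl⟩
  have h : loopBracket (k := k) (c := c) (d := d) (Pi.single i (conc f g)) =
      loopBracket (k := k) (Pi.single j (conc g f)) := by
    unfold loopBracket
    rw [LinearMap.lsum_piSingle, LinearMap.lsum_piSingle]
    exact LinearMap.ext fun h => mu_dbracket_comm f g h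
  change loopBracket (k := k) (c := c) (d := d) _ = 0
  rw [map_sub, h, sub_self]

/-- The bracket `{ , } = μ ∘ ⦃ , ⦄ : 𝓒_♮ ⊗ 𝓒 → 𝓒` induced by the double bracket. -/
def bracket {c d : Γ.Glued} : Γ.Cyc k →ₗ[k] Γ.Mor k c d →ₗ[k] Γ.Mor k c d :=
  (Γ.commutators k).liftQ (loopBracket (k := k) (c := c) (d := d)) (commutators_le_ker c d)

/-! ### The boundary measurement matrix and the completion -/

variable (Γ k) in
/-- The entry `b_{ij}` of the boundary measurement matrix: the sum of the weights of all directed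
paths in the network from the `i`-th source to the `j`-th sink. -/
def bdry (i j : Fin N) : Γ.Mor k (Γ.pt i) (Γ.pt j) :=
  ∑ p : Quiver.Path (Γ.source i) (Γ.sink j), ofPath (Γ.glue.mapPath p)

variable (Γ k) in
/-- The entries of the identity matrix. -/
def unit (i j : Fin N) : Γ.Mor k (Γ.pt i) (Γ.pt j) :=
  if h : i = j then h ▸ ofPath Quiver.Path.nil else 0

variable (Γ k) in
/-- The entries of the matrix `X = B - 1`. -/
def shifted (i j : Fin N) : Γ.Mor k (Γ.pt i) (Γ.pt j) := Γ.bdry k i j - Γ.unit k i j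

variable (Γ k) in
/-- The composable monomials of length `m` in the entries of `X = B - 1`. -/
inductive IsMonomial : (m : ℕ) → (i j : Fin N) → Γ.Mor k (Γ.pt i) (Γ.pt j) → Prop
  | one (i : Fin N) : IsMonomial 0 i i (Γ.unit k i i)
  | mul {m : ℕ} {i l : Fin N} {f : Γ.Mor k (Γ.pt i) (Γ.pt l)} (hf : IsMonomial m i l f)
      (j : Fin N) : IsMonomial (m + 1) i j (conc f (Γ.shifted k l j))

variable (Γ k) in
/-- `𝓒_(m)(i, j)`: the span of the monomials of length `m` in the entries of `X = B - 1`. -/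
def homog (m : ℕ) (i j : Fin N) : Submodule k (Γ.Mor k (Γ.pt i) (Γ.pt j)) :=
  Submodule.span k {f | Γ.IsMonomial k m i j f}

theorem unit_self (i : Fin N) : Γ.unit k i i = ofPath Quiver.Path.nil := by simp [unit]

theorem unit_mem (i j : Fin N) : Γ.unit k i j ∈ Γ.homog k 0 i j := by
  by_cases h : i = j
  · subst h
    exact Submodule.subset_span (IsMonomial.one i)
  · simp [unit, h]

theorem conc_mem {m n : ℕ} {i j l : Fin N} {f : Γ.Mor k (Γ.pt i) (Γ.pt j)}
    {g : Γ.Mor k (Γ.pt j) (Γ.pt l)} (hf : f ∈ Γ.homog k m i j) (hg : g ∈ Γ.homog k n j l) :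
    conc f g ∈ Γ.homog k (m + n) i l := by
  have key : ∀ {n : ℕ} {j l : Fin N} {g : Γ.Mor k (Γ.pt j) (Γ.pt l)}, Γ.IsMonomial k n j l g →
      ∀ {f : Γ.Mor k (Γ.pt i) (Γ.pt j)}, Γ.IsMonomial k m i j f →
      Γ.IsMonomial k (m + n) i l (conc f g) := by
    intro n j l g hg
    induction hg with
    | one j => intro f hf; rw [unit_self, conc_nil]; exact hf
    | mul _ l ih => intro f hf; rw [← conc_assoc]; exact (ih hf).mul l
  induction hf using Submodule.span_induction with
  | zero => simp
  | add x y _ _ hx hy => rw [map_add, LinearMap.add_apply]; exact add_mem hx hy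
  | smul r x _ hx => rw [map_smul, LinearMap.smul_apply]; exact Submodule.smul_mem _ r hx
  | mem f hf =>
    induction hg using Submodule.span_induction with
    | zero => simp
    | add x y _ _ hx hy => rw [map_add]; exact add_mem hx hy
    | smul r x _ hx => rw [map_smul]; exact Submodule.smul_mem _ r hx
    | mem g hg => exact Submodule.subset_span (key hg hf)

theorem shifted_mem (i j : Fin N) : Γ.shifted k i j ∈ Γ.homog k 1 i j := by
  refine Submodule.subset_span ?_
  have h := (IsMonomial.one (Γ := Γ) (k := k) i).mul j
  have hn : conc (Γ.unit k i i) (Γ.shifted k i j) = Γ.shifted k i j := by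
    rw [unit_self, nil_conc]
  rw [hn] at h
  exact h

variable (Γ k) in
/-- The formal power series `𝓒̂(i, j) = ∏ₘ 𝓒_(m)(i, j)` in the entries of `X = B - 1`. -/
abbrev Hat (i j : Fin N) : Type _ := ∀ m : ℕ, Γ.homog k m i j

variable (Γ k) in
/-- `N × N` matrices over the completion, the `(i, j)` entry being a series of paths `i → j`. -/
abbrev HatMat : Type _ := ∀ i j : Fin N, Γ.Hat k i j

theorem conc_mem_of_mem_antidiagonal {i j l : Fin N} (f : Γ.Hat k i j) (g : Γ.Hat k j l) {m : ℕ}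
    (p : ℕ × ℕ) (hp : p ∈ Finset.HasAntidiagonal.antidiagonal m) :
    conc (f p.1).1 (g p.2).1 ∈ Γ.homog k m i l := by
  have h := conc_mem (f p.1).2 (g p.2).2
  rwa [Finset.HasAntidiagonal.mem_antidiagonal.mp hp] at h

/-- The product of two composable formal power series: the Cauchy product. -/
def hatMul {i j l : Fin N} (f : Γ.Hat k i j) (g : Γ.Hat k j l) : Γ.Hat k i l := fun m =>
  ⟨∑ p ∈ Finset.HasAntidiagonal.antidiagonal m, conc (f p.1).1 (g p.2).1,
    Submodule.sum_mem _ fun p hp => conc_mem_of_mem_antidiagonal f g p hp⟩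

/-- The product of matrices over the completion. -/
def matMul (P Q : Γ.HatMat k) : Γ.HatMat k := fun i j => ∑ l, hatMul (P i l) (Q l j)

variable (Γ k) in
/-- The identity matrix over the completion. -/
def matOne : Γ.HatMat k := fun i j m =>
  if h : m = 0 then ⟨Γ.unit k i j, h ▸ unit_mem i j⟩ else 0

/-- The powers of a matrix over the completion. -/
def matPow (P : Γ.HatMat k) : ℕ → Γ.HatMat k
  | 0 => Γ.matOne k
  | n + 1 => matMul (matPow P n) P

/-- `log P = ∑_{n ≥ 1} (-1)ⁿ⁺¹/n (P - 1)ⁿ`, for matrices `P` such that `P - 1` has no terms of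
degree `0`; then only the terms with `n ≤ m` contribute to the homogeneous component of
degree `m`. -/
def matLog (P : Γ.HatMat k) : Γ.HatMat k := fun i j m =>
  ∑ n ∈ Finset.Icc 1 m, ((-1 : k) ^ (n + 1) / (n : k)) • matPow (P - Γ.matOne k) n i j m

variable (Γ k) in
/-- The boundary measurement matrix `B = 1 + X` over the completion. -/
def matB : Γ.HatMat k := fun i j m =>
  if h : m = 0 then ⟨Γ.unit k i j, h ▸ unit_mem i j⟩
  else if h : m = 1 then ⟨Γ.shifted k i j, h ▸ shifted_mem i j⟩
  else 0

variable (Γ k) in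
/-- `(𝓒_♮)_(m)`: the classes of loops in `𝓒_(m)`. -/
def cycHomog (m : ℕ) : Submodule k (Γ.Cyc k) :=
  ⨆ i : Fin N, (Γ.homog k m i i).map (toCyc i)

variable (Γ k) in
/-- The completion `∏ₘ (𝓒_♮)_(m)` of the cyclic space. -/
abbrev CycHat : Type _ := ∀ m : ℕ, Γ.cycHomog k m

/-- The trace of a matrix over the completion, in the completed cyclic space. -/
def cycTrace (P : Γ.HatMat k) : Γ.CycHat k := fun m =>
  ∑ i, ⟨toCyc i (P i i m), Submodule.mem_iSup_of_mem i (Submodule.mem_map_of_mem (P i i m).2)⟩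

variable (Γ k) in
/-- The Hamiltonian: the class of `(1/2) tr (log B)²` in the completed cyclic space. -/
def hamiltonian : Γ.CycHat k :=
  (1 / 2 : k) • cycTrace (matMul (matLog (Γ.matB k)) (matLog (Γ.matB k)))

/-- `IsBracket h c f` means that `f = {h, c}`, for the extension by continuity of the bracket to
formal power series: modulo terms of degree at least `D`, the brackets of the truncations of `h` and
`c` agree eventually with the truncation of `f`. -/
def IsBracket {i j : Fin N} (h : Γ.CycHat k) (c f : Γ.Hat k i j) : Prop :=
  ∀ D : ℕ, ∃ K₀ : ℕ, ∀ K ≥ K₀,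
    bracket (∑ m ∈ Finset.range K, (h m : Γ.Cyc k))
        (∑ n ∈ Finset.range K, (c n : Γ.Mor k (Γ.pt i) (Γ.pt j))) -
      ∑ d ∈ Finset.range D, (f d : Γ.Mor k (Γ.pt i) (Γ.pt j)) ∈ ⨆ d ≥ D, Γ.homog k d i j

variable (Γ k) in
/-- The matrix `M`: half of `log B` above the diagonal, minus half of `log B` below it, and `0` on
the diagonal. -/
def matM : Γ.HatMat k := fun i j =>
  if i < j then (1 / 2 : k) • matLog (Γ.matB k) i j
  else if j < i then -((1 / 2 : k) • matLog (Γ.matB k) i j)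
  else 0

end

end DiskNetwork

/-! The proof computes the double bracket of two boundary measurements and then differentiates a
function of one matrix.

Double bracket. By the Leibniz rules `⦃b_ij, b_ml⦄` is a sum over pairs of paths with one marked
edge in each, meeting at a vertex. Exchanging the tails there turns it into a sum over pairs `p : m
→ j`, `q : i → l` of `p ⊗ q`, weighted by an intersection number which adds local contributions of
pairs of edges (`dbracket_allPaths_eq_crossing`). This number depends only on the end points. On the
sphere obtained by collapsing the boundary, `q` is a closed curve, so its edge count is the
coboundary of a function `W` on faces (`exists_coboundary_eq`, a dimension count from Euler's
formula). The contributions along `p` then telescope to the difference of the values of `W` around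
the two ends of `p`, and along the boundary `W` jumps only at source `i` and sink `l`. Hence `⦃b_ij,
b_ml⦄ = ½ (sgn(i-m) + sgn(j-l)) b_mj ⊗ b_il` (`dbracket_bdry`).

Hamiltonian. By cyclicity of the trace, `{tr φ(X), B} = M_G B - B M_G` with `G = B φ'(X)`, where
`M_G` is half of `G` above the diagonal, minus half of `G` below it, and `0` on it (`rAction`,
`bracket_traceXPow`). For `φ(t) = ½ log(1+t)²` one has `(1+t) φ'(t) = log(1+t)`, so `G = log B`. A
truncation of the Hamiltonian leaves a single error term of top degree (`bracket_sum_hamiltonian`),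
which gives convergence.

Uniqueness. A limit is unique because the spaces of monomials of different degrees in `X` are
independent (`eq_zero_of_mem_homog_of_mem_tail`). They are eigenspaces, with eigenvalues `2^m`, of
an operator that scales every entry of `X` by `2`; a path from source `i` to sink `i` is needed to
absorb the constant in `b_ii - 1`. -/

namespace DiskNetwork

/-! ### Circulations on a planar network -/

section Planar

variable {N : ℕ} (Γ : DiskNetwork N)

instance : Finite (NetVertex Γ.V N) := by
  refine Finite.of_injective (β := Γ.V ⊕ (Fin N ⊕ Fin N)) (fun x => match x with
    | .internal v => Sum.inl v
    | .source i => Sum.inr (Sum.inl i)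
    | .sink i => Sum.inr (Sum.inr i)) ?_
  intro x y h
  cases x <;> cases y <;> simp_all

theorem tgt_ne_source (e : Γ.E) (i : Fin N) : Γ.tgt e ≠ .source i := fun h => by
  have := (Γ.source_univalent i (Sum.inr e)).mp h
  simp at this

theorem src_ne_sink (e : Γ.E) (i : Fin N) : Γ.src e ≠ .sink i := fun h => by
  have := (Γ.sink_univalent i (Sum.inl e)).mp h
  simp at this

theorem src_eq_source_iff (e : Γ.E) (i : Fin N) : Γ.src e = .source i ↔ e = Γ.sourceEdge i := by
  simpa [halfEdgeVertex] using Γ.source_univalent i (Sum.inl e)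

theorem tgt_eq_sink_iff (e : Γ.E) (i : Fin N) : Γ.tgt e = .sink i ↔ e = Γ.sinkEdge i := by
  simpa [halfEdgeVertex] using Γ.sink_univalent i (Sum.inr e)

theorem src_sourceEdge (i : Fin N) : Γ.src (Γ.sourceEdge i) = .source i :=
  (Γ.src_eq_source_iff _ i).mpr rfl

theorem tgt_sinkEdge (i : Fin N) : Γ.tgt (Γ.sinkEdge i) = .sink i :=
  (Γ.tgt_eq_sink_iff _ i).mpr rfl

/-- From every internal vertex, the boundary is reached by following edges. -/
theorem vertex_induction {P : NetVertex Γ.V N → Prop} (source : ∀ i, P (.source i))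
    (sink : ∀ i, P (.sink i))
    (internal : ∀ v e, Γ.src e = .internal v → P (Γ.tgt e) → P (.internal v)) (x) : P x := by
  let R : NetVertex Γ.V N → NetVertex Γ.V N → Prop := fun x y => ∃ e, Γ.src e = x ∧ Γ.tgt e = y
  have hwf : WellFounded (fun x y => Relation.TransGen R y x) :=
    haveI : Std.Irrefl (fun x y => Relation.TransGen R y x) := ⟨Γ.acyclic⟩
    haveI : IsTrans _ (fun x y => Relation.TransGen R y x) := ⟨fun _ _ _ h h' => h'.trans h⟩
    Finite.wellFounded_of_trans_of_irrefl _
  induction x using hwf.induction with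
  | _ x ih =>
    cases x with
    | source i => exact source i
    | sink i => exact sink i
    | internal v =>
      obtain ⟨e, he⟩ := Γ.not_sink v
      exact internal v e he (ih _ (Relation.TransGen.single ⟨e, he, rfl⟩))

/-- The vertices of the graph on the sphere: `none` stands for the boundary circle, collapsed to
a point. -/
def collapse {V : Type} : NetVertex V N → Option V
  | .internal v => some v
  | .source _ => none
  | .sink _ => none

/-- The vertex on the sphere to which a half-edge is attached. -/
def dartVertex (d : Γ.E ⊕ Γ.E) : Option Γ.V := collapse (halfEdgeVertex Γ.src Γ.tgt d)

theorem collapse_eq_some {V : Type} {x : NetVertex V N} {v : V} :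
    collapse x = some v ↔ x = .internal v := by
  cases x <;> simp [collapse]

theorem dartVertex_eq_none {d : Γ.E ⊕ Γ.E} (h : Γ.dartVertex d = none) :
    (∃ i, d = Sum.inl (Γ.sourceEdge i)) ∨ ∃ i, d = Sum.inr (Γ.sinkEdge i) := by
  unfold dartVertex at h
  match hd : halfEdgeVertex Γ.src Γ.tgt d with
  | .internal v => simp [hd, collapse] at h
  | .source i => exact Or.inl ⟨i, (Γ.source_univalent i d).mp hd⟩
  | .sink i => exact Or.inr ⟨i, (Γ.sink_univalent i d).mp hd⟩

theorem dartVertex_sourceEdge (i : Fin N) : Γ.dartVertex (Sum.inl (Γ.sourceEdge i)) = none := by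
  simp [dartVertex, halfEdgeVertex, src_sourceEdge, collapse]

theorem dartVertex_sinkEdge (i : Fin N) : Γ.dartVertex (Sum.inr (Γ.sinkEdge i)) = none := by
  simp [dartVertex, halfEdgeVertex, tgt_sinkEdge, collapse]

/-- At the collapsed boundary point the four boundary axioms give the image under `rot` of every
source and sink edge, which is again a boundary edge. -/
theorem dartVertex_rot (d : Γ.E ⊕ Γ.E) : Γ.dartVertex (Γ.rot d) = Γ.dartVertex d := by
  match hd : Γ.dartVertex d with
  | some v => exact collapse_eq_some.mpr (Γ.rot_vertex v d (collapse_eq_some.mp hd))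
  | none =>
    obtain ⟨⟨i, hi⟩, rfl⟩ | ⟨⟨i, hi⟩, rfl⟩ := Γ.dartVertex_eq_none hd
    · cases i with
      | zero => rw [Γ.rot_first _ rfl, dartVertex_sinkEdge]
      | succ i => rw [Γ.rot_source ⟨i, by omega⟩ ⟨i + 1, hi⟩ rfl, dartVertex_sourceEdge]
    · by_cases h : i + 1 = N
      · rw [Γ.rot_last _ h, dartVertex_sourceEdge]
      · rw [Γ.rot_sink _ ⟨i + 1, by omega⟩ rfl, dartVertex_sinkEdge]

/-- A function on half-edges which does not change along edges and around vertices is constant. -/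
theorem eq_of_invariant {α : Type*} (W : Γ.E ⊕ Γ.E → α) (hedge : ∀ e, W (Sum.inl e) = W (Sum.inr e))
    (hrot : ∀ d, W (Γ.rot d) = W d) (d d' : Γ.E ⊕ Γ.E) : W d = W d' := by
  have hpow : ∀ {d d'}, Γ.rot.SameCycle d d' → W d = W d' := by
    rintro d _ ⟨n, rfl⟩
    induction n with
    | zero => rfl
    | succ n ih => rw [ih, add_comm, zpow_add, Equiv.Perm.mul_apply, zpow_one, hrot]
    | pred n ih =>
      rw [ih, sub_eq_add_neg, add_comm, zpow_add, Equiv.Perm.mul_apply, zpow_neg_one, ← hrot (Γ.rot⁻¹ _),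
        ← Equiv.Perm.mul_apply, mul_inv_cancel, Equiv.Perm.one_apply]
  -- The boundary axioms chain every boundary half-edge to the first sink edge, which serves as base
  -- point.
  have hsource : ∀ (n : ℕ) (hn : n < N) (h0 : 0 < N),
      W (Sum.inl (Γ.sourceEdge ⟨n, hn⟩)) = W (Sum.inr (Γ.sinkEdge ⟨0, h0⟩)) := by
    intro n hn h0
    induction n with
    | zero => rw [← hrot, Γ.rot_first _ rfl]
    | succ n ih => rw [← hrot, Γ.rot_source ⟨n, by omega⟩ ⟨n + 1, hn⟩ rfl, ih]
  have hsink : ∀ (n : ℕ) (hn : n < N) (h0 : 0 < N),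
      W (Sum.inr (Γ.sinkEdge ⟨n, hn⟩)) = W (Sum.inr (Γ.sinkEdge ⟨0, h0⟩)) := by
    intro n hn h0
    induction n with
    | zero => rfl
    | succ n ih => rw [← ih (by omega), ← Γ.rot_sink ⟨n, by omega⟩ ⟨n + 1, hn⟩ rfl, hrot]
  have hbdry : ∀ {d d'}, Γ.dartVertex d = none → Γ.dartVertex d' = none → W d = W d' := by
    intro d d' hd hd'
    obtain ⟨⟨i, hi⟩, rfl⟩ | ⟨⟨i, hi⟩, rfl⟩ := Γ.dartVertex_eq_none hd <;>
    obtain ⟨⟨i', hi'⟩, rfl⟩ | ⟨⟨i', hi'⟩, rfl⟩ := Γ.dartVertex_eq_none hd' <;>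
    simp only [hsource _ _ (Nat.zero_lt_of_lt hi), hsink _ _ (Nat.zero_lt_of_lt hi)]
  -- At an internal vertex, turn to an outgoing edge and follow it; acyclicity makes this end at the
  -- boundary.
  have key : ∀ x d, halfEdgeVertex Γ.src Γ.tgt d = x → ∃ d', Γ.dartVertex d' = none ∧ W d = W d' := by
    intro x
    induction x using Γ.vertex_induction with
    | source i => exact fun d hd => ⟨d, by simp [dartVertex, hd, collapse], rfl⟩
    | sink i => exact fun d hd => ⟨d, by simp [dartVertex, hd, collapse], rfl⟩
    | internal v e he ih =>
      intro d hd
      obtain ⟨d', hd', h⟩ := ih (Sum.inr e) rfl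
      exact ⟨d', hd', (hpow (Γ.rot_cyclic v d (Sum.inl e) hd he)).trans ((hedge e).trans h)⟩
  obtain ⟨c, hc, h⟩ := key _ d rfl
  obtain ⟨c', hc', h'⟩ := key _ d' rfl
  rw [h, h', hbdry hc hc']

/-- The faces of the graph on the sphere. -/
abbrev Face : Type :=
  Quotient (Equiv.Perm.SameCycle.setoid ((Equiv.sumComm Γ.E Γ.E).trans Γ.rot))

/-- The face to the right of a half-edge, if one moves away from its end point. -/
def face (d : Γ.E ⊕ Γ.E) : Γ.Face := Quotient.mk _ d

/-- The face to the left of a half-edge is the face to the right of its counterclockwise successor.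
All local face relations below come from this one. -/
theorem face_rot (d : Γ.E ⊕ Γ.E) : Γ.face (Γ.rot d) = Γ.face d.swap := by
  have h : Equiv.Perm.SameCycle ((Equiv.sumComm Γ.E Γ.E).trans Γ.rot) d.swap (Γ.rot d) :=
    ⟨1, by simp⟩
  exact (Quotient.sound h).symm

noncomputable section

variable (k : Type*) [Field k]

/-- The coboundary of a function on faces: the value to the left of an edge minus the value to the
right. -/
def coboundary : (Γ.Face → k) →ₗ[k] (Γ.E → k) where
  toFun W e := W (Γ.face (Sum.inr e)) - W (Γ.face (Sum.inl e))
  map_add' _ _ := by ext e; simp only [Pi.add_apply]; ring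
  map_smul' _ _ := by ext e; simp only [Pi.smul_apply, smul_eq_mul, RingHom.id_apply]; ring

open Classical in
/-- The indicator function of a vertex on the sphere. -/
def indicator (y x : Option Γ.V) : k := if y = x then 1 else 0

/-- The incidence matrix of the graph on the sphere. -/
def incidence : Matrix (Option Γ.V) Γ.E k := fun x e =>
  Γ.indicator k (Γ.dartVertex (Sum.inr e)) x - Γ.indicator k (Γ.dartVertex (Sum.inl e)) x

/-- The net flow at a vertex is the sum of the jumps of `W` met on a full turn around it. Each
sector is entered once and left once, so rotating the summation index cancels everything. -/
theorem incidence_mulVec_coboundary (W : Γ.Face → k) [Fintype Γ.E] :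
    (Γ.incidence k).mulVec (Γ.coboundary k W) = 0 := by
  classical
  ext x
  let f : Γ.E ⊕ Γ.E → k := fun d => if Γ.dartVertex d = x then W (Γ.face d) else 0
  let g : Γ.E ⊕ Γ.E → k := fun d => if Γ.dartVertex d = x then W (Γ.face d.swap) else 0
  have h : ∑ d, f d = ∑ d, g d := by
    rw [← Equiv.sum_comp Γ.rot f]
    exact Finset.sum_congr rfl fun d _ => by simp only [f, g, dartVertex_rot, face_rot]
  rw [Fintype.sum_sum_type, Fintype.sum_sum_type, ← sub_eq_zero, ← Finset.sum_add_distrib,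
    ← Finset.sum_add_distrib, ← Finset.sum_sub_distrib] at h
  rw [Pi.zero_apply, ← h]
  refine Finset.sum_congr rfl fun e _ => ?_
  simp only [incidence, indicator, coboundary, LinearMap.coe_mk, AddHom.coe_mk, f, g, Sum.swap_inl,
    Sum.swap_inr]
  split_ifs <;> ring

/-- A function without jumps is constant, since the graph on the sphere is connected. -/
theorem finrank_ker_coboundary_le : Module.finrank k (LinearMap.ker (Γ.coboundary k)) ≤ 1 := by
  by_cases hE : Nonempty (Γ.E ⊕ Γ.E)
  · obtain ⟨d₀⟩ := hE
    let one : LinearMap.ker (Γ.coboundary k) :=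
      ⟨fun _ => 1, by rw [LinearMap.mem_ker]; ext e; simp [coboundary]⟩
    refine finrank_le_one one fun W => ⟨W.1 (Γ.face d₀), Subtype.ext (funext fun F => ?_)⟩
    have hW : ∀ e, W.1 (Γ.face (Sum.inl e)) = W.1 (Γ.face (Sum.inr e)) := fun e =>
      (sub_eq_zero.mp (congrFun (LinearMap.mem_ker.mp W.2) e)).symm
    induction F using Quotient.inductionOn with
    | _ d =>
      simp only [SetLike.val_smul, Pi.smul_apply, smul_eq_mul, mul_one, one]
      refine Γ.eq_of_invariant (fun d => W.1 (Γ.face d)) hW (fun d => ?_) d₀ d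
      rw [face_rot]
      cases d with
      | inl e => exact (hW e).symm
      | inr e => exact hW e
  · have hF : IsEmpty Γ.Face := ⟨fun F => Quotient.inductionOn F fun d => hE ⟨d⟩⟩
    have : Subsingleton (LinearMap.ker (Γ.coboundary k)) := inferInstance
    rw [Module.finrank_zero_of_subsingleton]
    exact zero_le_one

/-- The kernel of the transpose consists of vertex functions that are constant along edges. Every
vertex is joined to the boundary point, so only constants remain, and the rank is at least `(|V| +
1) - 1`. -/
theorem card_le_rank_incidence [Fintype Γ.E] [Fintype Γ.V] :
    Fintype.card Γ.V ≤ (Γ.incidence k).rank := by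
  classical
  rw [← Matrix.rank_transpose]
  have h := LinearMap.finrank_range_add_finrank_ker (Γ.incidence k).transpose.mulVecLin
  rw [Module.finrank_fintype_fun_eq_card, Fintype.card_option] at h
  have hmul : ∀ (g : Option Γ.V → k) (e : Γ.E), (Γ.incidence k).transpose.mulVec g e =
      g (Γ.dartVertex (Sum.inr e)) - g (Γ.dartVertex (Sum.inl e)) := by
    intro g e
    simp [Matrix.mulVec, dotProduct, incidence, indicator, sub_mul, Finset.sum_sub_distrib]
  have hker : Module.finrank k (LinearMap.ker (Γ.incidence k).transpose.mulVecLin) ≤ 1 := by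
    let one : LinearMap.ker (Γ.incidence k).transpose.mulVecLin :=
      ⟨fun _ => 1, by rw [LinearMap.mem_ker, Matrix.mulVecLin_apply]; ext e; simp [hmul]⟩
    refine finrank_le_one one fun g => ⟨g.1 none, Subtype.ext (funext fun x => ?_)⟩
    have hg : ∀ e, g.1 (Γ.dartVertex (Sum.inr e)) = g.1 (Γ.dartVertex (Sum.inl e)) := fun e => by
      have := congrFun (LinearMap.mem_ker.mp g.2) e
      rw [Matrix.mulVecLin_apply, hmul] at this
      exact sub_eq_zero.mp this
    simp only [SetLike.val_smul, Pi.smul_apply, smul_eq_mul, mul_one, one]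
    have key : ∀ y : NetVertex Γ.V N, g.1 (collapse y) = g.1 none := by
      intro y
      induction y using Γ.vertex_induction with
      | source i => rfl
      | sink i => rfl
      | internal v e he ih =>
        have := hg e
        simp only [dartVertex, halfEdgeVertex, Sum.elim_inr, Sum.elim_inl, he] at this
        rw [← this, ih]
    cases x with
    | none => rfl
    | some v => exact (key (.internal v)).symm
  change Fintype.card Γ.V ≤ Module.finrank k (LinearMap.range _)
  omega

/-- On a planar network every circulation is a coboundary: there is no homology in degree one. -/
theorem exists_coboundary_eq [Fintype Γ.E] (χ : Γ.E → k) (hχ : (Γ.incidence k).mulVec χ = 0) :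
    ∃ W, Γ.coboundary k W = χ := by
  classical
  have := Fintype.ofFinite Γ.V
  have := Fintype.ofFinite Γ.Face
  have hle : LinearMap.range (Γ.coboundary k) ≤ LinearMap.ker (Γ.incidence k).mulVecLin := by
    rintro _ ⟨W, rfl⟩
    exact Γ.incidence_mulVec_coboundary k W
  have h1 := LinearMap.finrank_range_add_finrank_ker (Γ.coboundary k)
  have h2 := LinearMap.finrank_range_add_finrank_ker (Γ.incidence k).mulVecLin
  have h3 := Γ.finrank_ker_coboundary_le k
  have h4 : _ ≤ Module.finrank k (LinearMap.range (Γ.incidence k).mulVecLin) :=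
    Γ.card_le_rank_incidence k
  have h5 := Γ.euler
  rw [Module.finrank_fintype_fun_eq_card] at h1 h2
  rw [Nat.card_eq_fintype_card, Nat.card_eq_fintype_card, Nat.card_eq_fintype_card] at h5
  -- The coboundary has rank at least `F - 1`, the circulations have dimension at most `E - V`, and
  -- Euler's formula says that these bounds agree.
  have hfin : Module.finrank k (LinearMap.ker (Γ.incidence k).mulVecLin) ≤
      Module.finrank k (LinearMap.range (Γ.coboundary k)) := by
    change _ + Fintype.card Γ.Face = _ at h5
    omega
  have heq := Submodule.eq_of_le_of_finrank_le hle hfin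
  have hmem : χ ∈ LinearMap.ker (Γ.incidence k).mulVecLin := hχ
  rw [← heq] at hmem
  exact hmem

end

end Planar

end DiskNetwork

namespace DiskNetwork

/-! ### Intersection numbers of paths -/

section Intersection

variable {N : ℕ} (Γ : DiskNetwork N)

/-- The three half-edges at an internal vertex. -/
theorem rot_trivalent {v : Γ.V} {d : Γ.E ⊕ Γ.E}
    (hd : halfEdgeVertex Γ.src Γ.tgt d = .internal v) :
    Γ.rot (Γ.rot (Γ.rot d)) = d ∧ ∀ d', halfEdgeVertex Γ.src Γ.tgt d' = .internal v →
      d' = d ∨ d' = Γ.rot d ∨ d' = Γ.rot (Γ.rot d) := by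
  classical
  have := Fintype.ofFinite Γ.E
  let S : Finset (Γ.E ⊕ Γ.E) :=
    Finset.univ.filter fun d => halfEdgeVertex Γ.src Γ.tgt d = .internal v
  have hS : ∀ {d'}, d' ∈ S ↔ halfEdgeVertex Γ.src Γ.tgt d' = .internal v := by simp [S]
  have hcard : S.card = 3 := by
    rw [← Γ.trivalent v, Nat.card_eq_fintype_card, Fintype.card_subtype]
  have hrot : ∀ {d'}, d' ∈ S → Γ.rot d' ∈ S := fun h => hS.mpr (Γ.rot_vertex v _ (hS.mp h))
  -- `rot` is transitive on the half-edges at `v`, so a `rot`-stable set containing `d` contains all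
  -- three. An orbit with a coincidence among `d`, `rot d`, `rot (rot d)` would be too small.
  have hclosed : ∀ T : Finset (Γ.E ⊕ Γ.E), d ∈ T → (∀ d' ∈ T, Γ.rot d' ∈ T) → S ⊆ T := by
    intro T hT h d' hd'
    obtain ⟨n, -, -, rfl⟩ := (Γ.rot_cyclic v d d' hd (hS.mp hd')).exists_pow_eq
    clear hd'
    induction n with
    | zero => exact hT
    | succ n ih => rw [pow_succ', Equiv.Perm.mul_apply]; exact h _ ih
  have h1 : Γ.rot d ≠ d := fun h => by
    have := Finset.card_le_card (hclosed {d} (by simp) (by simp [h]))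
    simp [hcard] at this
  have h2 : Γ.rot (Γ.rot d) ≠ d := fun h => by
    have := (Finset.card_le_card (hclosed {d, Γ.rot d} (by simp) (by simp [h]))).trans
      Finset.card_le_two
    omega
  have h3 : Γ.rot (Γ.rot d) ≠ Γ.rot d := fun h => h1 (Γ.rot.injective h)
  have hsub : {d, Γ.rot d, Γ.rot (Γ.rot d)} ⊆ S := by
    have := hS.mpr hd
    intro x hx
    simp only [Finset.mem_insert, Finset.mem_singleton] at hx
    rcases hx with rfl | rfl | rfl
    exacts [this, hrot this, hrot (hrot this)]
  have heq := Finset.eq_of_subset_of_card_le hsub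
    (by rw [hcard, Finset.card_eq_three.mpr ⟨_, _, _, h1.symm, h2.symm, h3.symm, rfl⟩])
  have hall : ∀ d', halfEdgeVertex Γ.src Γ.tgt d' = .internal v →
      d' = d ∨ d' = Γ.rot d ∨ d' = Γ.rot (Γ.rot d) := fun d' hd' => by
    have := hS.mpr hd'
    rw [← heq] at this
    simpa using this
  refine ⟨?_, hall⟩
  rcases hall _ (hS.mp (hrot (hrot (hrot (hS.mpr hd))))) with h | h | h
  · exact h
  · exact absurd (Γ.rot.injective h) h2
  · exact absurd (Γ.rot.injective (Γ.rot.injective h)) h1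

theorem source_ne_sink (i j : Fin N) : Γ.source i ≠ Γ.sink j := fun h => by
  exact NetVertex.noConfusion rfl rfl (heq_of_eq h)

noncomputable section

variable {Γ} (k : Type*) [Field k]

open Classical in
/-- The number of times that a path passes through an edge. -/
def edgeCount {a : Γ.Vertex} : ∀ {b : Γ.Vertex}, Quiver.Path a b → Γ.E → k
  | _, .nil => 0
  | _, .cons p e => edgeCount p + Pi.single e.1 1

/-- The sum of a function over the edges of a path. -/
def edgeSum {A : Type*} [AddCommMonoid A] (h : Γ.E → A) {a : Γ.Vertex} :
    ∀ {b : Γ.Vertex}, Quiver.Path a b → A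
  | _, .nil => 0
  | _, .cons p e => edgeSum h p + h e.1

theorem sum_edgeCount_mul [Fintype Γ.E] (h : Γ.E → k) {a b : Γ.Vertex} (p : Quiver.Path a b) :
    ∑ e, edgeCount k p e * h e = edgeSum h p := by
  induction p with
  | nil => simp [edgeCount, edgeSum]
  | cons p e ih =>
    simp only [edgeCount, edgeSum, Pi.add_apply, add_mul, Finset.sum_add_distrib, ih]
    rw [Finset.sum_eq_single e.1 (fun e' _ h => by simp [h]) (by simp)]
    simp

/-- The boundary of a path telescopes to its end points. For a path from a source to a sink both
collapse to the same point, so its edge count is a circulation. -/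
theorem incidence_mulVec_edgeCount [Fintype Γ.E] {a b : Γ.Vertex} (p : Quiver.Path a b)
    (x : Option Γ.V) : (Γ.incidence k).mulVec (edgeCount k p) x =
      Γ.indicator k (collapse (N := N) b) x - Γ.indicator k (collapse (N := N) a) x := by
  classical
  induction p with
  | nil => simp [edgeCount]
  | cons p e ih =>
    rw [edgeCount, Matrix.mulVec_add, Pi.add_apply, ih, Matrix.mulVec_single_one]
    obtain ⟨e, rfl, rfl⟩ := e
    simp only [incidence, Matrix.col_apply, dartVertex, halfEdgeVertex, Sum.elim_inl, Sum.elim_inr]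
    ring

/-- Twice the average of a function on faces on the two sides of an edge. -/
def sideSum (W : Γ.Face → k) (e : Γ.E) : k := W (Γ.face (Sum.inl e)) + W (Γ.face (Sum.inr e))

/-- A path turning from `f` into `g` at `v` leaves one further half-edge `d` there, and only `d`
contributes: through the white sum if it is outgoing, through the black sum if it is incoming. The
edges `f` and `g` share the face on the side away from `d`, so their side sums differ exactly by the
jump of `W` across `d`, up to sign. -/
theorem whiteCoeff_sum_sub_blackCoeff_sum [CharZero k] [Fintype Γ.E] (W : Γ.Face → k)
    {f g : Γ.E} {v : Γ.V} (hf : Γ.tgt f = .internal v) (hg : Γ.src g = .internal v) :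
    ∑ e, Γ.coboundary k W e * Γ.whiteCoeff k g e - ∑ e, Γ.coboundary k W e * Γ.blackCoeff k f e =
      1 / 2 * (sideSum k W f - sideSum k W g) := by
  classical
  have hf' : halfEdgeVertex Γ.src Γ.tgt (Sum.inr f) = .internal v := hf
  have hg' : halfEdgeVertex Γ.src Γ.tgt (Sum.inl g) = .internal v := hg
  obtain ⟨h3, hall⟩ := Γ.rot_trivalent hf'
  obtain ⟨h3g, -⟩ := Γ.rot_trivalent hg'
  have hwc : ∀ e, Γ.whiteCoeff k g e = if Γ.src e = .internal v then
      (if Γ.rot (Sum.inl g) = Sum.inl e then 1 / 2 else 0) -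
      (if Γ.rot (Sum.inl e) = Sum.inl g then 1 / 2 else 0) else 0 := fun e => by
    simp [whiteCoeff, hg]
  have hbc : ∀ e, Γ.blackCoeff k f e = if Γ.tgt e = .internal v then
      (if Γ.rot (Sum.inr e) = Sum.inr f then 1 / 2 else 0) -
      (if Γ.rot (Sum.inr f) = Sum.inr e then 1 / 2 else 0) else 0 := fun e => by
    simp [blackCoeff, hf]
  have hface : ∀ d, W (Γ.face (Γ.rot d)) = W (Γ.face d.swap) := fun d => by rw [face_rot]
  rcases hall _ hg' with h | h | h
  · simp at h
  -- Counterclockwise order `f, g, d`: the third half-edge is to the left of the path.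
  · obtain ⟨d, hd⟩ : ∃ d, Γ.rot (Sum.inl g) = d := ⟨_, rfl⟩
    have hdf : Γ.rot d = Sum.inr f := by rw [← hd, h, h3]
    have hdv : halfEdgeVertex Γ.src Γ.tgt d = .internal v := by
      rw [← hd]; exact Γ.rot_vertex v _ hg'
    have e1 := hface (Sum.inr f)
    have e2 := hface (Sum.inl g)
    have e3 := hface d
    rw [hdf] at e3
    rw [hd] at e2
    rw [← h] at e1
    simp only [Sum.swap_inl, Sum.swap_inr] at e1 e2
    have hw : ∀ e, Γ.whiteCoeff k g e = if d = Sum.inl e then 1 / 2 else 0 := fun e => by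
      have h' : Γ.rot (Sum.inl e) ≠ Sum.inl g := fun h' => by
        have := Γ.rot.injective (h'.trans h)
        simp at this
      rw [hwc, hd]
      by_cases h'' : d = Sum.inl e
      · subst h''; simp [h', show Γ.src e = _ from hdv]
      · simp [h', h'']
    have hb : ∀ e, Γ.blackCoeff k f e = if d = Sum.inr e then 1 / 2 else 0 := fun e => by
      have h' : Γ.rot (Sum.inr e) = Sum.inr f ↔ d = Sum.inr e := by
        rw [← hdf, Γ.rot.injective.eq_iff, eq_comm]
      rw [hbc, ← h]
      by_cases h'' : d = Sum.inr e
      · subst h''; simp [h', show Γ.tgt e = _ from hdv]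
      · simp [h', h'']
    simp only [hw, hb, sideSum]
    cases d with
    | inl e =>
      simp [coboundary] at e1 e2 e3 ⊢
      rw [e1, e3, ← e2]; ring
    | inr e =>
      simp [coboundary] at e1 e2 e3 ⊢
      rw [e1, e3, ← e2]; ring
  -- Counterclockwise order `f, d, g`: the third half-edge is to the right of the path, and the
  -- signs are reversed.
  · obtain ⟨d, hd⟩ : ∃ d, Γ.rot (Sum.inr f) = d := ⟨_, rfl⟩
    have hdg : Γ.rot d = Sum.inl g := by rw [← hd, h]
    have hgf : Γ.rot (Sum.inl g) = Sum.inr f := by rw [h, h3]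
    have hdv : halfEdgeVertex Γ.src Γ.tgt d = .internal v := by
      rw [← hd]; exact Γ.rot_vertex v _ hf'
    have e1 := hface (Sum.inr f)
    have e2 := hface (Sum.inl g)
    have e3 := hface d
    rw [hdg] at e3
    rw [hgf] at e2
    rw [hd] at e1
    simp only [Sum.swap_inl, Sum.swap_inr] at e1 e2
    have hw : ∀ e, Γ.whiteCoeff k g e = if d = Sum.inl e then -(1 / 2) else 0 := fun e => by
      have h' : Γ.rot (Sum.inl e) = Sum.inl g ↔ d = Sum.inl e := by
        rw [← hdg, Γ.rot.injective.eq_iff, eq_comm]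
      rw [hwc, hgf]
      by_cases h'' : d = Sum.inl e
      · subst h''; simp [h', show Γ.src e = _ from hdv]
      · simp [h', h'']
    have hb : ∀ e, Γ.blackCoeff k f e = if d = Sum.inr e then -(1 / 2) else 0 := fun e => by
      have h' : Γ.rot (Sum.inr e) ≠ Sum.inr f := fun h' => by
        have := Γ.rot.injective (h'.trans hgf.symm)
        simp at this
      rw [hbc, hd]
      by_cases h'' : d = Sum.inr e
      · subst h''; simp [h', show Γ.tgt e = _ from hdv]
      · simp [h', h'']
    simp only [hw, hb, sideSum]
    cases d with
    | inl e =>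
      simp [coboundary] at e1 e2 e3 ⊢
      rw [e2, e3, ← e1]; ring
    | inr e =>
      simp [coboundary] at e1 e2 e3 ⊢
      rw [e2, e3, ← e1]; ring

variable (Γ) in
/-- The contribution of an edge `e` of a path and an edge `e'` of another path to the intersection
number of the paths. -/
def crossing (e e' : Γ.E) : k := Γ.whiteCoeff k e e' - Γ.blackCoeff k e e'

/-- The sign of `i - j`. -/
def sgn (i j : Fin N) : k := if j < i then 1 else if i < j then -1 else 0

theorem eq_nil_of_source {i : Fin N} {b : Γ.Vertex} (p : Quiver.Path (Γ.source i) b) {l : Fin N}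
    (h : b = Γ.source l) : i = l ∧ edgeCount k p = 0 := by
  cases p with
  | nil => exact ⟨NetVertex.source.inj h, rfl⟩
  | cons p e => exact absurd (e.2.2.trans h) (Γ.tgt_ne_source _ _)

/-- No edge enters a source, so a source edge can only be the first edge of a path. Together with
the analogue for sinks, this fixes the jumps of the potential of a path along the boundary. -/
theorem edgeCount_sourceEdge {i : Fin N} {b : Γ.Vertex} (p : Quiver.Path (Γ.source i) b)
    (hb : ∀ j, b ≠ Γ.source j) (j : Fin N) :
    edgeCount k p (Γ.sourceEdge j) = if i = j then 1 else 0 := by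
  classical
  induction p with
  | nil => exact absurd rfl (hb i)
  | cons p e ih =>
    rw [edgeCount, Pi.add_apply]
    by_cases hc : ∃ l, Γ.src e.1 = .source l
    · obtain ⟨l, hl⟩ := hc
      obtain ⟨rfl, h0⟩ := eq_nil_of_source k p (e.2.1.symm.trans hl)
      have he := (Γ.src_eq_source_iff e.1 i).mp hl
      have hinj : Γ.sourceEdge j = Γ.sourceEdge i ↔ i = j := by
        rw [← src_eq_source_iff, src_sourceEdge, NetVertex.source.injEq, eq_comm]
      rw [h0, he, Pi.zero_apply, zero_add, Pi.single_apply]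
      simp only [hinj]
    · push Not at hc
      have h : Γ.sourceEdge j ≠ e.1 := fun h => hc j ((Γ.src_eq_source_iff e.1 j).mpr h.symm)
      rw [ih fun l hl => hc l (e.2.1.trans hl), Pi.single_eq_of_ne h, add_zero]

theorem edgeCount_sinkEdge {a : Γ.Vertex} {l : Fin N} (p : Quiver.Path a (Γ.sink l))
    (ha : ∀ j, a ≠ Γ.sink j) (j : Fin N) :
    edgeCount k p (Γ.sinkEdge j) = if l = j then 1 else 0 := by
  classical
  have key : ∀ {b : Γ.Vertex} (p : Quiver.Path a b),
      edgeCount k p (Γ.sinkEdge j) = if b = Γ.sink j then 1 else 0 := by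
    intro b p
    induction p with
    | nil => rw [if_neg (ha j)]; rfl
    | @cons c d p e ih =>
      have h1 : c ≠ Γ.sink j := fun h => Γ.src_ne_sink e.1 j (e.2.1.trans h)
      have h2 : d = Γ.sink j ↔ Γ.sinkEdge j = e.1 := by
        rw [eq_comm (b := e.1), ← Γ.tgt_eq_sink_iff, e.2.2]; rfl
      rw [edgeCount, Pi.add_apply, ih, if_neg h1, zero_add, Pi.single_apply]
      simp only [h2]
  have h : Γ.sink l = Γ.sink j ↔ l = j := ⟨NetVertex.sink.inj, congrArg _⟩
  rw [key]
  simp only [h]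

/-- The white term of each edge is paired with the black term of the preceding edge, so that the
local identity at their common vertex makes the sum telescope. The unpaired terms at the two ends
vanish because the coefficients only see internal vertices. -/
theorem edgeSum_crossing [CharZero k] [Fintype Γ.E] (W : Γ.Face → k) {i j : Fin N}
    (p : Quiver.Path (Γ.source i) (Γ.sink j)) :
    edgeSum (fun e => ∑ e', Γ.coboundary k W e' * Γ.crossing k e e') p =
      1 / 2 * (sideSum k W (Γ.sourceEdge i) - sideSum k W (Γ.sinkEdge j)) := by
  have hb : ∀ {f g : Γ.E} {v : Γ.V}, Γ.tgt f = .internal v → Γ.src g = .internal v →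
      ∑ e, Γ.coboundary k W e * Γ.whiteCoeff k g e = ∑ e, Γ.coboundary k W e * Γ.blackCoeff k f e +
        1 / 2 * (sideSum k W f - sideSum k W g) := fun hf hg => by
    rw [← whiteCoeff_sum_sub_blackCoeff_sum k W hf hg]; ring
  -- Adding the white term of an arbitrary next edge `g` completes the pairing at the end point of
  -- `p`; this is the form that passes through the induction.
  have key : ∀ {b : Γ.Vertex} (p : Quiver.Path (Γ.source i) b) (g : Γ.E), Γ.src g = b →
      edgeSum (fun e => ∑ e', Γ.coboundary k W e' * Γ.crossing k e e') p +
        ∑ e, Γ.coboundary k W e * Γ.whiteCoeff k g e =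
          1 / 2 * (sideSum k W (Γ.sourceEdge i) - sideSum k W g) := by
    intro b p
    induction p with
    | nil =>
      intro g hg
      have := (Γ.src_eq_source_iff g i).mp hg
      subst this
      simp [edgeSum, whiteCoeff, src_sourceEdge]
    | @cons c d p f ih =>
      intro g hg
      have h := ih f.1 f.2.1
      have hgf : Γ.src g = Γ.tgt f.1 := hg.trans f.2.2.symm
      obtain ⟨x, hx⟩ : ∃ x, Γ.tgt f.1 = x := ⟨_, rfl⟩
      cases x with
      | source l => exact absurd hx (Γ.tgt_ne_source _ _)
      | sink l => exact absurd (hgf.trans hx) (Γ.src_ne_sink _ _)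
      | internal v =>
        rw [edgeSum, hb hx (hgf.trans hx)]
        simp only [crossing, mul_sub, Finset.sum_sub_distrib] at h ⊢
        linear_combination h
  have hlast : ∀ {b : Γ.Vertex} (p : Quiver.Path (Γ.source i) b), b = Γ.sink j →
      edgeSum (fun e => ∑ e', Γ.coboundary k W e' * Γ.crossing k e e') p =
        1 / 2 * (sideSum k W (Γ.sourceEdge i) - sideSum k W (Γ.sinkEdge j)) := by
    intro b p hb
    cases p with
    | nil => exact absurd hb (Γ.source_ne_sink i j)
    | cons p f =>
      have hf := (Γ.tgt_eq_sink_iff f.1 j).mp (f.2.2.trans hb)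
      have h0 : ∑ e, Γ.coboundary k W e * Γ.blackCoeff k (Γ.sinkEdge j) e = 0 := by
        simp [blackCoeff, tgt_sinkEdge]
      rw [edgeSum, ← hf, ← key p f.1 f.2.1]
      simp only [crossing, mul_sub, Finset.sum_sub_distrib]
      rw [hf, h0, sub_zero]
  exact hlast p rfl

/-- Going down either side of the disk from the top face, the potential drops by one at source `i`
on the left and at sink `l` on the right. Adding the values on both sides of an edge turns these
step functions into signs. -/
theorem sideSum_sourceEdge_sub_sinkEdge (W : Γ.Face → k) {i l : Fin N}
    (hsource : ∀ j, Γ.coboundary k W (Γ.sourceEdge j) = if i = j then 1 else 0)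
    (hsink : ∀ j, Γ.coboundary k W (Γ.sinkEdge j) = if l = j then 1 else 0) (m j : Fin N) :
    sideSum k W (Γ.sourceEdge m) - sideSum k W (Γ.sinkEdge j) = sgn k i m + sgn k j l := by
  have hface : ∀ d, W (Γ.face (Γ.rot d)) = W (Γ.face d.swap) := fun d => by rw [face_rot]
  have h0 : 0 < N := Nat.zero_lt_of_lt i.2
  -- `A` is the value on the top face, which is adjacent to both the first source and the first
  -- sink.
  obtain ⟨A, hA⟩ : ∃ A, W (Γ.face (Sum.inr (Γ.sourceEdge ⟨0, h0⟩))) = A := ⟨_, rfl⟩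
  have hr : ∀ (n : ℕ) (hn : n < N), W (Γ.face (Sum.inr (Γ.sourceEdge ⟨n, hn⟩))) =
      A - if (i : ℕ) < n then 1 else 0 := by
    intro n hn
    induction n with
    | zero => simp [hA]
    | succ n ih =>
      have h1 := hface (Sum.inl (Γ.sourceEdge ⟨n + 1, hn⟩))
      rw [Γ.rot_source ⟨n, by omega⟩ _ rfl] at h1
      have h2 := hsource ⟨n, by omega⟩
      simp only [coboundary, LinearMap.coe_mk, AddHom.coe_mk, Fin.ext_iff] at h2
      rw [Sum.swap_inl] at h1
      rw [← h1, eq_sub_of_add_eq' (sub_eq_iff_eq_add.mp h2).symm, ih (by omega)]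
      split_ifs <;> first | omega | ring
  have hl : ∀ (n : ℕ) (hn : n < N), W (Γ.face (Sum.inr (Γ.sinkEdge ⟨n, hn⟩))) =
      A - if (l : ℕ) < n then 1 else 0 := by
    intro n hn
    induction n with
    | zero =>
      have h1 := hface (Sum.inl (Γ.sourceEdge ⟨0, h0⟩))
      rw [Γ.rot_first _ rfl, Sum.swap_inl, hA] at h1
      simp [h1]
    | succ n ih =>
      have h1 := hface (Sum.inr (Γ.sinkEdge ⟨n, by omega⟩))
      rw [Γ.rot_sink ⟨n, by omega⟩ ⟨n + 1, hn⟩ rfl] at h1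
      have h2 := hsink ⟨n, by omega⟩
      simp only [coboundary, LinearMap.coe_mk, AddHom.coe_mk, Fin.ext_iff] at h2
      rw [Sum.swap_inr] at h1
      rw [h1, eq_sub_of_add_eq' (sub_eq_iff_eq_add.mp h2).symm, ih (by omega)]
      split_ifs <;> first | omega | ring
  have h1 := hsource m
  have h2 := hsink j
  have h3 := hr m m.2
  have h4 := hl j j.2
  simp only [coboundary, LinearMap.coe_mk, AddHom.coe_mk, Fin.ext_iff, Fin.eta] at h1 h2 h3 h4
  rw [sideSum, sideSum, eq_sub_of_add_eq' (sub_eq_iff_eq_add.mp h1).symm,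
    eq_sub_of_add_eq' (sub_eq_iff_eq_add.mp h2).symm, h3, h4]
  simp only [sgn, Fin.lt_def]
  split_ifs <;> first | omega | ring

/-- The intersection number of two paths depends only on their end points. -/
theorem intersection_number [CharZero k] {i j m l : Fin N}
    (p : Quiver.Path (Γ.source m) (Γ.sink j)) (q : Quiver.Path (Γ.source i) (Γ.sink l)) :
    edgeSum (fun e => edgeSum (fun e' => Γ.crossing k e e') q) p =
      1 / 2 * (sgn k i m + sgn k j l) := by
  classical
  have := Fintype.ofFinite Γ.E
  -- Planarity enters here: `W` plays the role of the winding number of the closed curve `q`.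
  obtain ⟨W, hW⟩ := Γ.exists_coboundary_eq k (edgeCount k q) (by
    ext x
    rw [incidence_mulVec_edgeCount]
    exact sub_self _)
  rw [← sideSum_sourceEdge_sub_sinkEdge k W
    (by rw [hW]; exact edgeCount_sourceEdge k q fun _ => (Γ.source_ne_sink _ _).symm)
    (by rw [hW]; exact edgeCount_sinkEdge k q fun _ => Γ.source_ne_sink _ _), ← edgeSum_crossing]
  congr 1
  ext e
  rw [hW, sum_edgeCount_mul]

end

end Intersection

end DiskNetwork

namespace DiskNetwork

/-! ### The double bracket of the boundary measurements -/

noncomputable section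

variable {N : ℕ} {Γ : DiskNetwork N}

instance : Fintype Γ.Vertex := @Fintype.ofFinite _ (inferInstanceAs (Finite (NetVertex Γ.V N)))

instance (a b : Γ.Vertex) : Fintype (a ⟶ b) :=
  @Fintype.ofFinite _ (inferInstanceAs (Finite {e : Γ.E // Γ.src e = a ∧ Γ.tgt e = b}))

instance (p : Prop) : Fintype (PLift p) := Fintype.ofFinite _

variable (Γ) in
/-- The edges of the network, with their end points. -/
abbrev Arrow : Type := Σ c d : Γ.Vertex, c ⟶ d

/-! ### Sums over the ways to split a path at an edge -/

section Split

variable {A : Type*} [AddCommMonoid A]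

/-- The sum of a function over all ways to split a path into an initial path, an edge and a final
path. -/
def splitSum {a : Γ.Vertex} : ∀ {b : Γ.Vertex}, (∀ ⦃c d : Γ.Vertex⦄, (c ⟶ d) →
    Quiver.Path a c → Quiver.Path d b → A) → Quiver.Path a b → A
  | _, _, .nil => 0
  | _, F, .cons p e => splitSum (fun _ _ e' p₁ p₂ => F e' p₁ (p₂.cons e)) p + F e p .nil

/-- The trivial path between equal vertices. -/
def nilOfEq {a b : Γ.Vertex} (h : PLift (a = b)) : Quiver.Path a b :=
  h.down ▸ (Quiver.Path.nil : Quiver.Path a a)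

/-- A path is trivial or has a last edge. -/
def pathEquiv (a b : Γ.Vertex) :
    Quiver.Path a b ≃ PLift (a = b) ⊕ (Σ y : (Σ c, (c ⟶ b)), Quiver.Path a y.1) where
  toFun p := match b, p with
    | _, .nil => Sum.inl ⟨rfl⟩
    | _, .cons p e => Sum.inr ⟨⟨_, e⟩, p⟩
  invFun
    | .inl h => nilOfEq h
    | .inr y => y.2.cons y.1.2
  left_inv p := by cases p <;> rfl
  right_inv
    | .inl ⟨h⟩ => by subst h; rfl
    | .inr _ => rfl

theorem sum_path {a b : Γ.Vertex} (G : Quiver.Path a b → A) :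
    ∑ p, G p = ∑ h : PLift (a = b), G (nilOfEq h) +
      ∑ y : (Σ c, (c ⟶ b)), ∑ p : Quiver.Path a y.1, G (p.cons y.2) := by
  rw [← Equiv.sum_comp (pathEquiv a b).symm, Fintype.sum_sum_type, Fintype.sum_sigma]
  rfl

theorem sum_plift_eq (b : Γ.Vertex) (G : ∀ d : Γ.Vertex, Quiver.Path d b → A) :
    ∑ d, ∑ h : PLift (d = b), G d (nilOfEq h) = G b .nil := by
  rw [Finset.sum_eq_single b]
  · rw [Fintype.sum_eq_single ⟨rfl⟩ (fun x hx => absurd (Subsingleton.elim _ _) hx)]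
    rfl
  · intro d _ hd
    exact Finset.sum_eq_zero fun h _ => absurd h.down hd
  · simp

theorem path_wellFounded : WellFounded (fun a b : Γ.Vertex =>
    Relation.TransGen (fun x y => ∃ e, Γ.src e = x ∧ Γ.tgt e = y) a b) := by
  let R : NetVertex Γ.V N → NetVertex Γ.V N → Prop :=
    Relation.TransGen (fun x y => ∃ e, Γ.src e = x ∧ Γ.tgt e = y)
  have : Std.Irrefl R := ⟨Γ.acyclic⟩
  have : IsTrans _ R := ⟨fun _ _ _ h h' => h.trans h'⟩
  exact Finite.wellFounded_of_trans_of_irrefl R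

/-- A path with a marked edge is the same as an edge with an arbitrary path before it and an
arbitrary path after it. The induction removes the last edge and runs over the end point in the
acyclic order. -/
theorem sum_splitSum {a b : Γ.Vertex} (F : ∀ ⦃c d : Γ.Vertex⦄, (c ⟶ d) →
    Quiver.Path a c → Quiver.Path d b → A) :
    ∑ p, splitSum F p = ∑ x : Γ.Arrow, ∑ p₁ : Quiver.Path a x.1, ∑ p₂ : Quiver.Path x.2.1 b,
      F x.2.2 p₁ p₂ := by
  induction b using path_wellFounded.induction with
  | _ b ih =>
    have h0 : ∀ h : PLift (a = b), splitSum F (nilOfEq h) = 0 := by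
      rintro ⟨rfl⟩
      rfl
    rw [sum_path]
    simp only [h0, Finset.sum_const_zero, zero_add, splitSum, Finset.sum_add_distrib]
    have h1 := fun y : (Σ c, (c ⟶ b)) => ih y.1
      (Relation.TransGen.single ⟨y.2.1, y.2.2.1, y.2.2.2⟩) 
      (fun _ _ e' p₁ p₂ => F e' p₁ (p₂.cons y.2))
    simp only [h1]
    have h2 : ∀ (x : Γ.Arrow) (p₁ : Quiver.Path a x.1), _ := fun x p₁ => sum_path (F x.2.2 p₁)
    simp only [h2, Finset.sum_add_distrib]
    rw [add_comm]
    congr 1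
    -- The marked edge is the last one, so the final path is trivial.
    · simp only [Fintype.sum_sigma]
      refine Finset.sum_congr rfl fun c _ => ?_
      rw [← sum_plift_eq b fun d p₂ => ∑ e : c ⟶ d, ∑ p₁ : Quiver.Path a c, F e p₁ p₂]
      refine Finset.sum_congr rfl fun d _ => ?_
      rw [Finset.sum_comm]
      refine Finset.sum_congr rfl fun e _ => ?_
      rw [Finset.sum_comm]
    · rw [Finset.sum_comm]
      refine Finset.sum_congr rfl fun x _ => ?_
      rw [Finset.sum_comm]

theorem edgeSum_smul {R : Type*} [Semiring R] [Module R A] (h : Γ.E → R) {a b : Γ.Vertex}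
    (φ : Quiver.Path a b → A) (p : Quiver.Path a b) :
    edgeSum h p • φ p = splitSum (fun _ _ e p₁ p₂ => h e.1 • φ ((p₁.cons e).comp p₂)) p := by
  induction p with
  | nil => exact zero_smul _ _
  | cons p e ih => rw [edgeSum, add_smul, ih fun p => φ (p.cons e)]; rfl

end Split

variable {k : Type*} [Field k]

variable (Γ k) in
/-- The sum of all paths of the network from `a` to `b`. -/
def allPaths (a b : Γ.Vertex) : Γ.Mor k (Γ.glue.obj a) (Γ.glue.obj b) :=
  ∑ p : Quiver.Path a b, ofPath (Γ.glue.mapPath p)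

variable (Γ k) in
/-- The sum of all paths of the network from `a` to `b`, with a distinguished passage through a
given edge. -/
def pathsThrough (a b : Γ.Vertex) (x : Γ.Arrow) : Γ.Mor k (Γ.glue.obj a) (Γ.glue.obj b) :=
  conc (conc (Γ.allPaths k a x.1) (ofEdge (Γ.glue.map x.2.2))) (Γ.allPaths k x.2.1 b)

/-! ### The four one-sided multiplications on tensors -/

theorem mulL1_sum {ι : Type*} (s : Finset ι) {a a' b c d : Γ.Glued} (f : ι → Γ.Mor k a a')
    (T : Γ.Mor k a' b ⊗[k] Γ.Mor k c d) : mulL1 (∑ i ∈ s, f i) T = ∑ i ∈ s, mulL1 (f i) T := by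
  change LinearMap.rTensorHom _ (conc _) T = _
  simp only [map_sum, LinearMap.sum_apply]
  rfl

theorem mulL2_sum {ι : Type*} (s : Finset ι) {a b c c' d : Γ.Glued} (f : ι → Γ.Mor k c c')
    (T : Γ.Mor k a b ⊗[k] Γ.Mor k c' d) : mulL2 (∑ i ∈ s, f i) T = ∑ i ∈ s, mulL2 (f i) T := by
  change LinearMap.lTensorHom _ (conc _) T = _
  simp only [map_sum, LinearMap.sum_apply]
  rfl

theorem mulR1_sum {ι : Type*} (s : Finset ι) {a b b' c d : Γ.Glued} (f : ι → Γ.Mor k b' b)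
    (T : Γ.Mor k a b' ⊗[k] Γ.Mor k c d) : mulR1 (∑ i ∈ s, f i) T = ∑ i ∈ s, mulR1 (f i) T := by
  change LinearMap.rTensorHom _ (conc.flip _) T = _
  simp only [map_sum, LinearMap.sum_apply]
  rfl

theorem mulR2_sum {ι : Type*} (s : Finset ι) {a b c d d' : Γ.Glued} (f : ι → Γ.Mor k d' d)
    (T : Γ.Mor k a b ⊗[k] Γ.Mor k c d') : mulR2 (∑ i ∈ s, f i) T = ∑ i ∈ s, mulR2 (f i) T := by
  change LinearMap.lTensorHom _ (conc.flip _) T = _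
  simp only [map_sum, LinearMap.sum_apply]
  rfl

theorem mulR1_nil {a b c d : Γ.Glued} (T : Γ.Mor k a b ⊗[k] Γ.Mor k c d) :
    mulR1 (ofPath .nil) T = T := by
  induction T with
  | zero => simp
  | add x y hx hy => rw [map_add, hx, hy]
  | tmul x y => simp only [mulR1, LinearMap.rTensor_tmul, LinearMap.flip_apply, conc_nil]

theorem mulR2_nil {a b c d : Γ.Glued} (T : Γ.Mor k a b ⊗[k] Γ.Mor k c d) :
    mulR2 (ofPath .nil) T = T := by
  induction T with
  | zero => simp
  | add x y hx hy => rw [map_add, hx, hy]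
  | tmul x y => simp only [mulR2, LinearMap.lTensor_tmul, LinearMap.flip_apply, conc_nil]

theorem mulR1_cons {a b b' b'' c d : Γ.Glued} (p : Quiver.Path b b') (e : b' ⟶ b'')
    (T : Γ.Mor k a b ⊗[k] Γ.Mor k c d) :
    mulR1 (ofPath (p.cons e)) T = mulR1 (ofEdge e) (mulR1 (ofPath p) T) := by
  induction T with
  | zero => simp
  | add x y hx hy => simp only [map_add, hx, hy]
  | tmul x y =>
    simp only [mulR1, LinearMap.rTensor_tmul, LinearMap.flip_apply, ofPath_cons, conc_assoc]

theorem mulR2_cons {a b c d d' d'' : Γ.Glued} (p : Quiver.Path d d') (e : d' ⟶ d'')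
    (T : Γ.Mor k a b ⊗[k] Γ.Mor k c d) :
    mulR2 (ofPath (p.cons e)) T = mulR2 (ofEdge e) (mulR2 (ofPath p) T) := by
  induction T with
  | zero => simp
  | add x y hx hy => simp only [map_add, hx, hy]
  | tmul x y =>
    simp only [mulR2, LinearMap.lTensor_tmul, LinearMap.flip_apply, ofPath_cons, conc_assoc]

theorem mulR1_mulL2 {a b b' c c' d : Γ.Glued} (f : Γ.Mor k b' b) (g : Γ.Mor k c c')
    (T : Γ.Mor k a b' ⊗[k] Γ.Mor k c' d) : mulR1 f (mulL2 g T) = mulL2 g (mulR1 f T) := by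
  induction T with
  | zero => simp
  | add x y hx hy => simp only [map_add, hx, hy]
  | tmul x y => rfl

theorem mulR2_mulL1 {a a' b c d d' : Γ.Glued} (f : Γ.Mor k d' d) (g : Γ.Mor k a a')
    (T : Γ.Mor k a' b ⊗[k] Γ.Mor k c d') : mulR2 f (mulL1 g T) = mulL1 g (mulR2 f T) := by
  induction T with
  | zero => simp
  | add x y hx hy => simp only [map_add, hx, hy]
  | tmul x y => rfl

/-! ### Leibniz expansion and reconnection of paths -/

theorem map_splitSum {A A' : Type*} [AddCommMonoid A] [AddCommMonoid A'] (φ : A →+ A')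
    {a b : Γ.Vertex} (F : ∀ ⦃c d : Γ.Vertex⦄, (c ⟶ d) → Quiver.Path a c → Quiver.Path d b → A)
    (p : Quiver.Path a b) : φ (splitSum F p) = splitSum (fun _ _ e p₁ p₂ => φ (F e p₁ p₂)) p := by
  induction p with
  | nil => exact map_zero _
  | cons p e ih => rw [splitSum, map_add, ih]; rfl

theorem pathEdgeBracket_mapPath {c d : Γ.Glued} (e' : c ⟶ d) {a b : Γ.Vertex}
    (p : Quiver.Path a b) :
    (pathEdgeBracket e' (Γ.glue.mapPath p) : Γ.Mor k c _ ⊗[k] Γ.Mor k _ d) =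
      splitSum (fun _ _ e p₁ p₂ => mulL2 (ofPath (Γ.glue.mapPath p₁))
        (mulR1 (ofPath (Γ.glue.mapPath p₂)) (edgeBracket (Γ.glue.map e) e'))) p := by
  induction p with
  | nil => rfl
  | cons p e ih =>
    rw [Prefunctor.mapPath_cons, pathEdgeBracket, ih, splitSum, add_comm]
    congr 1
    · refine (map_splitSum (mulR1 _).toAddMonoidHom _ p).trans ?_
      congr 1
      funext c d e' p₁ p₂
      rw [Prefunctor.mapPath_cons, mulR1_cons, LinearMap.toAddMonoidHom_coe, mulR1_mulL2]
    · rw [Prefunctor.mapPath_nil, mulR1_nil]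

theorem pathBracket_mapPath {a b : Γ.Glued} (f : Quiver.Path a b) {c d : Γ.Vertex}
    (q : Quiver.Path c d) :
    (pathBracket f (Γ.glue.mapPath q) : Γ.Mor k _ b ⊗[k] Γ.Mor k a _) =
      splitSum (fun _ _ e q₁ q₂ => mulL1 (ofPath (Γ.glue.mapPath q₁))
        (mulR2 (ofPath (Γ.glue.mapPath q₂)) (pathEdgeBracket (Γ.glue.map e) f))) q := by
  induction q with
  | nil => rfl
  | cons q e ih =>
    rw [Prefunctor.mapPath_cons, pathBracket, ih, splitSum, add_comm]
    congr 1
    · refine (map_splitSum (mulR2 _).toAddMonoidHom _ q).trans ?_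
      congr 1
      funext c d e' p₁ p₂
      rw [Prefunctor.mapPath_cons, mulR2_cons, LinearMap.toAddMonoidHom_coe, mulR2_mulL1]
    · rw [Prefunctor.mapPath_nil, mulR2_nil]

theorem sum_pathEdgeBracket {c d : Γ.Glued} (e' : c ⟶ d) (a b : Γ.Vertex) :
    ∑ p : Quiver.Path a b,
      (pathEdgeBracket e' (Γ.glue.mapPath p) : Γ.Mor k c _ ⊗[k] Γ.Mor k _ d) =
      ∑ x : Γ.Arrow, mulL2 (Γ.allPaths k a x.1)
        (mulR1 (Γ.allPaths k x.2.1 b) (edgeBracket (Γ.glue.map x.2.2) e')) := by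
  simp only [pathEdgeBracket_mapPath, sum_splitSum, allPaths, mulL2_sum, mulR1_sum, map_sum]
  exact Finset.sum_congr rfl fun x _ => Finset.sum_comm

theorem sum_pathBracket {a b : Γ.Glued} (f : Quiver.Path a b) (c d : Γ.Vertex) :
    ∑ q : Quiver.Path c d,
      (pathBracket f (Γ.glue.mapPath q) : Γ.Mor k _ b ⊗[k] Γ.Mor k a _) =
      ∑ x : Γ.Arrow, mulL1 (Γ.allPaths k c x.1)
        (mulR2 (Γ.allPaths k x.2.1 d) (pathEdgeBracket (Γ.glue.map x.2.2) f)) := by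
  simp only [pathBracket_mapPath, sum_splitSum, allPaths, mulL1_sum, mulR2_sum, map_sum]
  exact Finset.sum_congr rfl fun x _ => Finset.sum_comm

/-- Once both arguments are summed over all paths, the pieces before and after the marked edges vary
independently and become full path sums around the bracket of two edges. -/
theorem dbracket_allPaths (a b c d : Γ.Vertex) :
    dbracket (Γ.allPaths k a b) (Γ.allPaths k c d) = ∑ x' : Γ.Arrow, ∑ x : Γ.Arrow,
      mulL1 (Γ.allPaths k c x'.1) (mulR2 (Γ.allPaths k x'.2.1 d)
        (mulL2 (Γ.allPaths k a x.1) (mulR1 (Γ.allPaths k x.2.1 b)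
          (edgeBracket (Γ.glue.map x.2.2) (Γ.glue.map x'.2.2))))) := by
  have h : dbracket (Γ.allPaths k a b) (Γ.allPaths k c d) =
      ∑ p : Quiver.Path a b, ∑ q : Quiver.Path c d,
        pathBracket (Γ.glue.mapPath p) (Γ.glue.mapPath q) := by
    simp only [allPaths, map_sum, LinearMap.sum_apply, dbracket_ofPath]
    exact Finset.sum_comm
  rw [h, Finset.sum_congr rfl fun p _ => sum_pathBracket (Γ.glue.mapPath p) c d, Finset.sum_comm]
  refine Finset.sum_congr rfl fun x' _ => ?_
  rw [← map_sum, ← map_sum, ← map_sum, ← map_sum, sum_pathEdgeBracket]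

theorem sum_edgeSum_smul {A : Type*} [AddCommMonoid A] [Module k A] (h : Γ.E → k) (a b : Γ.Vertex)
    (φ : Γ.Mor k (Γ.glue.obj a) (Γ.glue.obj b) →ₗ[k] A) :
    ∑ p : Quiver.Path a b, edgeSum h p • φ (ofPath (Γ.glue.mapPath p)) =
      ∑ x : Γ.Arrow, h x.2.2.1 • φ (Γ.pathsThrough k a b x) := by
  simp only [edgeSum_smul h fun p => φ (ofPath (Γ.glue.mapPath p)), sum_splitSum]
  refine Finset.sum_congr rfl fun x _ => ?_
  simp only [pathsThrough, allPaths, map_sum, LinearMap.sum_apply, Finset.smul_sum,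
    Prefunctor.mapPath_comp, Prefunctor.mapPath_cons, ofPath_comp, ofPath_cons]
  rw [Finset.sum_comm]

theorem blackCoeff_swap (e e' : Γ.E) : Γ.blackCoeff k e' e = -Γ.blackCoeff k e e' := by
  have h : (∃ v, Γ.tgt e' = .internal v ∧ Γ.tgt e = .internal v) ↔
      ∃ v, Γ.tgt e = .internal v ∧ Γ.tgt e' = .internal v := exists_congr fun _ => and_comm
  unfold blackCoeff
  by_cases h' : ∃ v, Γ.tgt e = .internal v ∧ Γ.tgt e' = .internal v
  · rw [if_pos h', if_pos (h.mpr h')]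
    ring
  · rw [if_neg h', if_neg (h.not.mpr h'), neg_zero]

/-- The tails are exchanged at the common vertex. At a white vertex the marked edges come after it
and stay with the ends `b` and `d`; at a black vertex they come before it and stay with the starts
`a` and `c`. -/
theorem sandwich_edgeBracket (a b c d : Γ.Vertex) (x x' : Γ.Arrow) :
    mulL1 (Γ.allPaths k c x'.1) (mulR2 (Γ.allPaths k x'.2.1 d)
        (mulL2 (Γ.allPaths k a x.1) (mulR1 (Γ.allPaths k x.2.1 b)
          (edgeBracket (Γ.glue.map x.2.2) (Γ.glue.map x'.2.2))))) =
      Γ.whiteCoeff k x.2.2.1 x'.2.2.1 •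
        (Γ.pathsThrough k c b x ⊗ₜ[k] Γ.pathsThrough k a d x') +
      Γ.blackCoeff k x.2.2.1 x'.2.2.1 •
        (Γ.pathsThrough k c b x' ⊗ₜ[k] Γ.pathsThrough k a d x) := by
  obtain ⟨u, v, e⟩ := x
  obtain ⟨u', v', e'⟩ := x'
  rw [edgeBracket]
  simp only [map_add]
  congr 1
  -- Tails that agree after gluing may differ in the network, but the coefficient is nonzero only if
  -- both are the same internal vertex.
  · by_cases h : ∃ w : Γ.V, Γ.src e.1 = .internal w ∧ Γ.src e'.1 = .internal w
    · obtain ⟨w, hw, hw'⟩ := h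
      obtain rfl : u = u' := e.2.1.symm.trans (hw.trans (hw'.symm.trans e'.2.1))
      rw [dif_pos rfl]
      simp only [map_smul, pathsThrough, mulL1, mulL2, mulR1, mulR2, LinearMap.rTensor_tmul,
        LinearMap.lTensor_tmul, LinearMap.flip_apply, conc_assoc]
      rfl
    · have h0 : Γ.whiteCoeff k e.1 e'.1 = 0 := if_neg h
      have h0' : Γ.whiteCoeff k (Γ.glue.map e).1 (Γ.glue.map e').1 = 0 := h0
      simp [h0, h0']
  · by_cases h : ∃ w : Γ.V, Γ.tgt e.1 = .internal w ∧ Γ.tgt e'.1 = .internal w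
    · obtain ⟨w, hw, hw'⟩ := h
      obtain rfl : v = v' := e.2.2.symm.trans (hw.trans (hw'.symm.trans e'.2.2))
      rw [dif_pos rfl]
      simp only [map_smul, pathsThrough, mulL1, mulL2, mulR1, mulR2, LinearMap.rTensor_tmul,
        LinearMap.lTensor_tmul, LinearMap.flip_apply, conc_assoc]
      rfl
    · have h0 : Γ.blackCoeff k e.1 e'.1 = 0 := if_neg h
      have h0' : Γ.blackCoeff k (Γ.glue.map e).1 (Γ.glue.map e').1 = 0 := h0
      simp [h0, h0']

/-- The terms are collected by the pair of reconnected paths rather than by the original pair. The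
marked edges trade places in the black terms, and skew-symmetry of `blackCoeff` then produces the
minus sign in `crossing`. -/
theorem dbracket_allPaths_eq_crossing (a b c d : Γ.Vertex) :
    dbracket (Γ.allPaths k a b) (Γ.allPaths k c d) =
      ∑ p : Quiver.Path c b, ∑ q : Quiver.Path a d,
        edgeSum (fun e => edgeSum (fun e' => Γ.crossing k e e') q) p •
          ((ofPath (Γ.glue.mapPath p) : Γ.Mor k _ _) ⊗ₜ[k]
            (ofPath (Γ.glue.mapPath q) : Γ.Mor k _ _)) := by
  have h1 : ∀ q : Quiver.Path a d, ∑ p : Quiver.Path c b,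
      edgeSum (fun e => edgeSum (fun e' => Γ.crossing k e e') q) p •
          ((ofPath (Γ.glue.mapPath p) : Γ.Mor k _ _) ⊗ₜ[k]
            (ofPath (Γ.glue.mapPath q) : Γ.Mor k _ _)) = _ := fun q =>
    sum_edgeSum_smul _ c b ((TensorProduct.mk k _ _).flip (ofPath (Γ.glue.mapPath q)))
  have h2 : ∀ x : Γ.Arrow, ∑ q : Quiver.Path a d,
      edgeSum (fun e' => Γ.crossing k x.2.2.1 e') q •
          (Γ.pathsThrough k c b x ⊗ₜ[k] (ofPath (Γ.glue.mapPath q) : Γ.Mor k _ _)) = _ := fun x =>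
    sum_edgeSum_smul _ a d (TensorProduct.mk k _ _ (Γ.pathsThrough k c b x))
  rw [Finset.sum_comm]
  simp only [h1, LinearMap.flip_apply, TensorProduct.mk_apply]
  rw [Finset.sum_comm]
  simp only [h2, TensorProduct.mk_apply]
  simp only [dbracket_allPaths, sandwich_edgeBracket, crossing,
    sub_smul, Finset.sum_add_distrib, Finset.sum_sub_distrib]
  rw [sub_eq_add_neg, ← Finset.sum_neg_distrib]
  congr 1
  · rw [Finset.sum_comm]
  · simp only [← Finset.sum_neg_distrib, ← neg_smul, ← blackCoeff_swap]

/-- The double bracket of the boundary measurements is given by the standard r-matrix. -/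
theorem dbracket_bdry [CharZero k] (i j m l : Fin N) :
    dbracket (Γ.bdry k i j) (Γ.bdry k m l) =
      (1 / 2 * (sgn k i m + sgn k j l) : k) • (Γ.bdry k m j ⊗ₜ[k] Γ.bdry k i l) := by
  refine (dbracket_allPaths_eq_crossing (Γ.source i) (Γ.sink j) (Γ.source m) (Γ.sink l)).trans ?_
  simp only [intersection_number]
  simp only [← Finset.smul_sum, ← TensorProduct.tmul_sum, ← TensorProduct.sum_tmul]
  rfl

end

end DiskNetwork

namespace DiskNetwork

/-! ### Brackets with traces of powers -/

noncomputable section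

variable {N : ℕ} {Γ : DiskNetwork N} {k : Type*} [Field k]

variable (Γ k) in
/-- The entries of the powers of `X = B - 1`. -/
def xPow : ℕ → ∀ i j : Fin N, Γ.Mor k (Γ.pt i) (Γ.pt j)
  | 0 => Γ.unit k
  | n + 1 => fun i j => ∑ l, conc (xPow n i l) (Γ.shifted k l j)

theorem unit_of_ne {i j : Fin N} (h : i ≠ j) : Γ.unit k i j = 0 := dif_neg h

theorem unit_conc_sum {b : Γ.Glued} (i : Fin N) (f : ∀ l : Fin N, Γ.Mor k (Γ.pt l) b) :
    ∑ l, conc (Γ.unit k i l) (f l) = f i := by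
  rw [Finset.sum_eq_single i (fun l _ h => by rw [unit_of_ne h.symm, map_zero]; rfl) (by simp),
    unit_self, nil_conc]

theorem conc_unit_sum {a : Γ.Glued} (j : Fin N) (f : ∀ l : Fin N, Γ.Mor k a (Γ.pt l)) :
    ∑ l, conc (f l) (Γ.unit k l j) = f j := by
  rw [Finset.sum_eq_single j (fun l _ h => by rw [unit_of_ne h, map_zero]) (by simp),
    unit_self, conc_nil]

theorem xPow_add (m n : ℕ) (i j : Fin N) :
    ∑ l, conc (Γ.xPow k m i l) (Γ.xPow k n l j) = Γ.xPow k (m + n) i j := by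
  induction n generalizing j with
  | zero => exact conc_unit_sum j _
  | succ n ih =>
    rw [← add_assoc]
    simp only [xPow, map_sum, ← ih, LinearMap.sum_apply, conc_assoc]
    exact Finset.sum_comm

theorem bdry_eq (i j : Fin N) : Γ.bdry k i j = Γ.unit k i j + Γ.shifted k i j := by
  rw [shifted, add_sub_cancel]

theorem xPow_one (i j : Fin N) : Γ.xPow k 1 i j = Γ.shifted k i j := unit_conc_sum i _

theorem bdry_conc_xPow (n : ℕ) (i j : Fin N) :
    ∑ l, conc (Γ.bdry k i l) (Γ.xPow k n l j) = Γ.xPow k n i j + Γ.xPow k (n + 1) i j := by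
  simp only [bdry_eq, map_add, LinearMap.add_apply, Finset.sum_add_distrib]
  rw [unit_conc_sum, add_comm n, ← xPow_add]
  simp only [xPow_one]

theorem xPow_conc_bdry (n : ℕ) (i j : Fin N) :
    ∑ l, conc (Γ.xPow k n i l) (Γ.bdry k l j) = Γ.xPow k n i j + Γ.xPow k (n + 1) i j := by
  simp only [bdry_eq, map_add, Finset.sum_add_distrib]
  rw [conc_unit_sum]
  rfl

theorem dbracket_conc_left {a b b' c d : Γ.Glued} (f : Γ.Mor k a b) (g : Γ.Mor k b b')
    (h : Γ.Mor k c d) :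
    dbracket (conc f g) h = mulL2 f (dbracket g h) + mulR1 g (dbracket f h) := by
  have hL : ∀ (f : Γ.Mor k a b) (T : Γ.Mor k c b' ⊗[k] Γ.Mor k b d),
    mulL2 f T = LinearMap.lTensorHom _ (conc f) T := fun _ _ => rfl
  have hR : ∀ (g : Γ.Mor k b b') (T : Γ.Mor k c b ⊗[k] Γ.Mor k a d),
    mulR1 g T = LinearMap.rTensorHom _ (conc.flip g) T := fun _ _ => rfl
  simp only [hL, hR]
  induction f using mor_induction with
  | zero => simp only [map_zero, LinearMap.zero_apply, add_zero]
  | add f f' hf hf' => simp only [map_add, LinearMap.add_apply, hf, hf']; abel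
  | smul r f hf => simp only [map_smul, LinearMap.smul_apply, hf, smul_add]
  | path p =>
    induction g using mor_induction with
    | zero => simp only [map_zero, LinearMap.zero_apply, add_zero]
    | add f f' hf hf' => simp only [map_add, LinearMap.add_apply, hf, hf']; abel
    | smul r f hf => simp only [map_smul, LinearMap.smul_apply, hf, smul_add]
    | path q =>
      induction h using mor_induction with
      | zero => simp only [map_zero, add_zero]
      | add f f' hf hf' => simp only [map_add, hf, hf']; abel
      | smul r f hf => simp only [map_smul, hf, smul_add]
      | path u =>
        rw [← ofPath_comp, dbracket_ofPath, dbracket_ofPath, dbracket_ofPath, pathBracket_comp]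
        rfl

theorem dbracket_nil_left {a c d : Γ.Glued} (h : Γ.Mor k c d) :
    dbracket (ofPath (.nil : Quiver.Path a a)) h = 0 := by
  induction h using mor_induction with
  | zero => exact map_zero _
  | add f f' hf hf' => rw [map_add, hf, hf', add_zero]
  | smul r f hf => rw [map_smul, hf, smul_zero]
  | path u =>
    rw [dbracket_ofPath]
    induction u with
    | nil => rfl
    | cons u e ih => rw [pathBracket, ih, pathEdgeBracket, map_zero, map_zero, add_zero]

theorem dbracket_unit_left {c d : Γ.Glued} (i j : Fin N) (h : Γ.Mor k c d) :
    dbracket (Γ.unit k i j) h = 0 := by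
  by_cases hij : i = j
  · subst hij
    rw [unit_self, dbracket_nil_left]
  · rw [unit_of_ne hij, map_zero]
    rfl

theorem dbracket_shifted [CharZero k] (i j m l : Fin N) :
    dbracket (Γ.shifted k i j) (Γ.bdry k m l) =
      (1 / 2 * (sgn k i m + sgn k j l) : k) • (Γ.bdry k m j ⊗ₜ[k] Γ.bdry k i l) := by
  rw [shifted, map_sub, LinearMap.sub_apply, dbracket_unit_left, sub_zero, dbracket_bdry]

/-- Leibniz rule: `r` is the number of factors before the one that is differentiated, and `n - 1 -
r` the number after it. -/
theorem dbracket_xPow [CharZero k] (n : ℕ) (i j m l : Fin N) :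
    dbracket (Γ.xPow k n i j) (Γ.bdry k m l) = ∑ r ∈ Finset.range n, ∑ u, ∑ v,
      (1 / 2 * (sgn k u m + sgn k v l) : k) •
        (conc (Γ.bdry k m v) (Γ.xPow k (n - 1 - r) v j) ⊗ₜ[k]
          conc (Γ.xPow k r i u) (Γ.bdry k u l)) := by
  induction n generalizing j with
  | zero => simp [xPow, dbracket_unit_left]
  | succ n ih =>
    simp only [xPow, map_sum, LinearMap.sum_apply, dbracket_conc_left, dbracket_shifted,
      Finset.sum_add_distrib]
    rw [Finset.sum_range_succ, add_comm]
    congr 1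
    · simp only [ih, map_sum, map_smul, mulR1, LinearMap.rTensor_tmul, LinearMap.flip_apply,
        conc_assoc]
      rw [Finset.sum_comm]
      refine Finset.sum_congr rfl fun r hr => ?_
      rw [Finset.sum_comm]
      refine Finset.sum_congr rfl fun u _ => ?_
      rw [Finset.sum_comm]
      refine Finset.sum_congr rfl fun v _ => ?_
      rw [← Finset.smul_sum, ← TensorProduct.sum_tmul, ← map_sum]
      have hn : n + 1 - 1 - r = (n - 1 - r) + 1 := by
        have := Finset.mem_range.mp hr
        omega
      rw [hn]
      rfl
    · refine Finset.sum_congr rfl fun u _ => ?_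
      -- When the last factor is differentiated, `X⁰ = 1` follows it, which forces `v = j`.
      rw [Finset.sum_eq_single j]
      · simp only [add_tsub_cancel_right, tsub_self, xPow, unit_self, conc_nil, mulL2, map_smul,
          LinearMap.lTensor_tmul]
      · intro v _ hv
        simp only [add_tsub_cancel_right, tsub_self, xPow, unit_of_ne hv, map_zero,
          TensorProduct.zero_tmul, smul_zero]
      · simp

theorem bracket_toCyc (i : Fin N) {c d : Γ.Glued} (f : Γ.Mor k (Γ.pt i) (Γ.pt i))
    (g : Γ.Mor k c d) : bracket (toCyc i f) g = mu (dbracket f g) := by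
  change loopBracket (LinearMap.single k (fun i => Γ.Mor k (Γ.pt i) (Γ.pt i)) i f) g = _
  rw [loopBracket, LinearMap.coe_single, LinearMap.lsum_piSingle]
  rfl

variable (Γ k) in
/-- The class of the trace of `Xⁿ` in the cyclic space. -/
def traceXPow (n : ℕ) : Γ.Cyc k := ∑ i, toCyc i (Γ.xPow k n i i)

/-- The action of the r-matrix on a matrix `G`, multiplied by `B`. -/
def rAction (G : ∀ i j : Fin N, Γ.Mor k (Γ.pt i) (Γ.pt j)) (m l : Fin N) :
    Γ.Mor k (Γ.pt m) (Γ.pt l) :=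
  ∑ u, conc ((1 / 2 * sgn k u m) • G m u) (Γ.bdry k u l) +
    ∑ v, conc (Γ.bdry k m v) ((1 / 2 * sgn k v l) • G v l)

theorem rAction_add (G G' : ∀ i j : Fin N, Γ.Mor k (Γ.pt i) (Γ.pt j)) (m l : Fin N) :
    rAction (G + G') m l = rAction G m l + rAction G' m l := by
  simp only [rAction, Pi.add_apply, smul_add, map_add, LinearMap.add_apply,
    Finset.sum_add_distrib]
  abel

theorem rAction_smul (r : k) (G : ∀ i j : Fin N, Γ.Mor k (Γ.pt i) (Γ.pt j)) (m l : Fin N) :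
    rAction (r • G) m l = r • rAction G m l := by
  simp only [rAction, Pi.smul_apply, map_smul, LinearMap.smul_apply, Finset.smul_sum, smul_add,
    smul_comm r]

/-- After concatenation the factors on both sides of the differentiated one join to `Xⁿ`, so all `n
+ 1` positions contribute the same sum of `b_mv (Xⁿ)_vu b_ul`. Each of the two signs involves only
one of `u`, `v`; the free sum over the other gives `B Xⁿ = Xⁿ B = Xⁿ + Xⁿ⁺¹`. -/
theorem bracket_traceXPow [CharZero k] (n : ℕ) (m l : Fin N) :
    bracket (Γ.traceXPow k (n + 1)) (Γ.bdry k m l) =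
      ((n : k) + 1) • rAction (Γ.xPow k n + Γ.xPow k (n + 1)) m l := by
  have h : ∀ r ∈ Finset.range (n + 1), ∀ u v : Fin N,
      ∑ i, conc (conc (Γ.bdry k m v) (Γ.xPow k (n + 1 - 1 - r) v i))
        (conc (Γ.xPow k r i u) (Γ.bdry k u l)) =
      conc (conc (Γ.bdry k m v) (Γ.xPow k n v u)) (Γ.bdry k u l) := by
    intro r hr u v
    have hn : n + 1 - 1 - r + r = n := by
      have := Finset.mem_range.mp hr
      omega
    conv_rhs => rw [← hn, ← xPow_add]
    simp only [map_sum, LinearMap.sum_apply, conc_assoc]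
  have h1 : bracket (Γ.traceXPow k (n + 1)) (Γ.bdry k m l) =
      ∑ r ∈ Finset.range (n + 1), ∑ u, ∑ v, (1 / 2 * (sgn k u m + sgn k v l) : k) •
        conc (conc (Γ.bdry k m v) (Γ.xPow k n v u)) (Γ.bdry k u l) := by
    simp only [traceXPow, map_sum, LinearMap.sum_apply, bracket_toCyc, dbracket_xPow, map_smul,
      mu, TensorProduct.lift.tmul]
    rw [Finset.sum_comm]
    refine Finset.sum_congr rfl fun r hr => ?_
    rw [Finset.sum_comm]
    refine Finset.sum_congr rfl fun u _ => ?_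
    rw [Finset.sum_comm]
    refine Finset.sum_congr rfl fun v _ => ?_
    rw [← Finset.smul_sum, h r hr]
  rw [h1, Finset.sum_const, Finset.card_range, ← Nat.cast_smul_eq_nsmul k, Nat.cast_succ]
  congr 1
  simp only [rAction, Pi.add_apply]
  simp only [← bdry_conc_xPow n m]
  simp only [← xPow_conc_bdry n _ l]
  simp only [mul_add, add_smul, Finset.sum_add_distrib]
  congr 1
  · simp only [← map_smul, Finset.smul_sum, map_sum, LinearMap.sum_apply]
    simp only [map_smul, LinearMap.smul_apply]
  · rw [Finset.sum_comm]
    simp only [Finset.smul_sum, map_sum, map_smul, conc_assoc]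

end

end DiskNetwork

namespace DiskNetwork

/-! ### Components of the power series -/

noncomputable section

variable {N : ℕ} {Γ : DiskNetwork N} {k : Type*} [Field k]

variable (k) in
/-- The coefficients of the logarithm. -/
def logCoeff (n : ℕ) : k := (-1) ^ (n + 1) / n

variable (k) in
/-- The coefficients of half of the square of the logarithm. -/
def halfSqLogCoeff (n : ℕ) : k :=
  1 / 2 * ∑ p ∈ Finset.HasAntidiagonal.antidiagonal n, logCoeff k p.1 * logCoeff k p.2

/-- Division by zero gives zero, so the logarithm may be summed from `n = 0`. -/
theorem logCoeff_zero : logCoeff k 0 = 0 := by simp [logCoeff]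

/-- The coefficientwise form of `(1+t) φ'(t) = log(1+t)` for `φ(t) = ½ log(1+t)²`. This identity is
why the bracket with the Hamiltonian produces `log B`. -/
theorem halfSqLogCoeff_rec [CharZero k] (n : ℕ) :
    n * halfSqLogCoeff k n + (n + 1) * halfSqLogCoeff k (n + 1) = logCoeff k n := by
  let L : PowerSeries k := PowerSeries.mk (logCoeff k)
  have hL : (1 + PowerSeries.X) * PowerSeries.derivative k L = 1 := by
    ext m
    rw [add_mul, one_mul, map_add]
    cases m with
    | zero => simp [PowerSeries.coeff_derivative, L, logCoeff]
    | succ m =>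
      have h1 : (m : k) + 1 ≠ 0 := by exact_mod_cast m.succ_ne_zero
      have h2 : (m : k) + 1 + 1 ≠ 0 := by exact_mod_cast (m + 1).succ_ne_zero
      simp [PowerSeries.coeff_derivative, L, logCoeff, PowerSeries.coeff_one,
        PowerSeries.coeff_succ_X_mul, h1, h2]
      ring
  have hc : ∀ m, PowerSeries.coeff m (PowerSeries.C (1 / 2 : k) * (L * L)) =
      halfSqLogCoeff k m := fun m => by
    rw [PowerSeries.coeff_C_mul]
    simp [PowerSeries.coeff_mul, L, halfSqLogCoeff]
  have hD : PowerSeries.derivative k (PowerSeries.C (1 / 2 : k) * (L * L)) =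
      L * PowerSeries.derivative k L := by
    have h2 : PowerSeries.C (1 / 2 : k) * 2 = 1 := by
      rw [show (2 : PowerSeries k) = PowerSeries.C 2 from (map_ofNat _ 2).symm, ← map_mul]
      simp
    rw [Derivation.leibniz, Derivation.leibniz, PowerSeries.derivative_C]
    simp only [smul_eq_mul, mul_zero, add_zero]
    linear_combination L * PowerSeries.derivative k L * h2
  have h : (1 + PowerSeries.X) * PowerSeries.derivative k (PowerSeries.C (1 / 2 : k) * (L * L)) =
      L := by
    rw [hD]
    linear_combination L * hL
  have hn := congrArg (PowerSeries.coeff n) h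
  rw [add_mul, one_mul, map_add] at hn
  have hLn : PowerSeries.coeff n L = logCoeff k n := by simp [L]
  rw [hLn] at hn
  rw [← hn]
  cases n with
  | zero => simp only [PowerSeries.coeff_derivative, hc]; simp
  | succ n =>
    simp only [PowerSeries.coeff_derivative, hc, PowerSeries.coeff_succ_X_mul]
    push_cast
    ring

theorem hatMul_coe {i j l : Fin N} (f : Γ.Hat k i j) (g : Γ.Hat k j l) (m : ℕ) :
    (hatMul f g m : Γ.Mor k (Γ.pt i) (Γ.pt l)) =
      ∑ p ∈ Finset.HasAntidiagonal.antidiagonal m, conc (f p.1).1 (g p.2).1 := rfl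

theorem matMul_coe (P Q : Γ.HatMat k) (i j : Fin N) (m : ℕ) :
    (matMul P Q i j m : Γ.Mor k (Γ.pt i) (Γ.pt j)) =
      ∑ l, ∑ p ∈ Finset.HasAntidiagonal.antidiagonal m, conc (P i l p.1).1 (Q l j p.2).1 := by
  rw [matMul, Finset.sum_apply, AddSubmonoidClass.coe_finsetSum]
  rfl

theorem matB_sub_matOne_coe (i j : Fin N) (m : ℕ) :
    ((Γ.matB k - Γ.matOne k) i j m : Γ.Mor k (Γ.pt i) (Γ.pt j)) =
      if m = 1 then Γ.shifted k i j else 0 := by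
  rw [Pi.sub_apply, Pi.sub_apply, Pi.sub_apply, matB, matOne]
  rcases m with _ | _ | m <;> simp

/-- `X` is concentrated in degree `1`, hence `Xⁿ` in degree `n`. -/
theorem matPow_coe (n : ℕ) (i j : Fin N) (m : ℕ) :
    (matPow (Γ.matB k - Γ.matOne k) n i j m : Γ.Mor k (Γ.pt i) (Γ.pt j)) =
      if m = n then Γ.xPow k n i j else 0 := by
  induction n generalizing j m with
  | zero =>
    rw [matPow, matOne]
    split_ifs <;> rfl
  | succ n ih =>
    rw [matPow, matMul_coe]
    simp only [ih, matB_sub_matOne_coe]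
    have h : ∀ l, ∑ p ∈ Finset.HasAntidiagonal.antidiagonal m,
        conc (if p.1 = n then Γ.xPow k n i l else 0) (if p.2 = 1 then Γ.shifted k l j else 0) =
        if m = n + 1 then conc (Γ.xPow k n i l) (Γ.shifted k l j) else 0 := by
      intro l
      split_ifs with hm
      · subst hm
        rw [Finset.sum_eq_single (n, 1)]
        · simp
        · rintro ⟨p, q⟩ hpq hne
          rw [Finset.HasAntidiagonal.mem_antidiagonal] at hpq
          have : p ≠ n := fun hp => hne (by simp at hpq ⊢; omega)
          simp [this]
        · simp
      · refine Finset.sum_eq_zero fun p hp => ?_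
        rw [Finset.HasAntidiagonal.mem_antidiagonal] at hp
        by_cases h1 : p.1 = n
        · have : p.2 ≠ 1 := by omega
          simp [this]
        · simp [h1]
    simp only [h]
    split_ifs with hm
    · rfl
    · simp

theorem matLog_coe (i j : Fin N) (m : ℕ) :
    (matLog (Γ.matB k) i j m : Γ.Mor k (Γ.pt i) (Γ.pt j)) = logCoeff k m • Γ.xPow k m i j := by
  rw [matLog, AddSubmonoidClass.coe_finsetSum]
  simp only [Submodule.coe_smul, matPow_coe, smul_ite, smul_zero]
  rw [Finset.sum_ite_eq]
  split_ifs with h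
  · rfl
  · have : m = 0 := by
      rw [Finset.mem_Icc] at h
      omega
    rw [this, logCoeff_zero, zero_smul]

theorem cycTrace_coe (P : Γ.HatMat k) (m : ℕ) :
    (cycTrace P m : Γ.Cyc k) = ∑ i, toCyc i (P i i m).1 := by
  rw [cycTrace, AddSubmonoidClass.coe_finsetSum]

theorem hamiltonian_coe (m : ℕ) :
    (Γ.hamiltonian k m : Γ.Cyc k) = halfSqLogCoeff k m • Γ.traceXPow k m := by
  rw [hamiltonian, Pi.smul_apply, Submodule.coe_smul, cycTrace_coe, halfSqLogCoeff, mul_smul]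
  congr 1
  simp only [matMul_coe, matLog_coe, traceXPow, Finset.smul_sum]
  refine Finset.sum_congr rfl fun i _ => ?_
  rw [← map_smul]
  congr 1
  rw [Finset.sum_comm, Finset.sum_smul]
  refine Finset.sum_congr rfl fun p hp => ?_
  rw [← Finset.HasAntidiagonal.mem_antidiagonal.mp hp, ← xPow_add, Finset.smul_sum]
  simp only [map_smul, LinearMap.smul_apply, mul_smul, smul_comm (logCoeff k p.1)]

variable (Γ k) in
/-- The truncation of `log B`. -/
def logTrunc (K : ℕ) : ∀ i j : Fin N, Γ.Mor k (Γ.pt i) (Γ.pt j) := fun i j =>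
  ∑ n ∈ Finset.range K, (matLog (Γ.matB k) i j n : Γ.Mor k (Γ.pt i) (Γ.pt j))

theorem traceXPow_zero_bracket (m l : Fin N) : bracket (Γ.traceXPow k 0) (Γ.bdry k m l) = 0 := by
  simp [traceXPow, bracket_toCyc, xPow, dbracket_unit_left]

/-- With `c_n` the coefficients of the Hamiltonian, the bracket collects `n c_n (Xⁿ⁻¹ + Xⁿ)`.
Neighbouring terms combine by the recursion to the coefficients of the logarithm, except that in top
degree `K` the summand from `c_{K+1}` is missing. -/
theorem bracket_sum_hamiltonian [CharZero k] (K : ℕ) (m l : Fin N) :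
    bracket (∑ n ∈ Finset.range (K + 1), (Γ.hamiltonian k n : Γ.Cyc k)) (Γ.bdry k m l) =
      rAction (Γ.logTrunc k (K + 1) - ((K + 1) * halfSqLogCoeff k (K + 1)) • Γ.xPow k K) m l := by
  induction K with
  | zero =>
    have h : Γ.logTrunc k (0 + 1) - (((0 : ℕ) + 1) * halfSqLogCoeff k (0 + 1)) • Γ.xPow k 0 =
        (0 : k) • Γ.xPow k 0 := by
      ext i j : 2
      have := halfSqLogCoeff_rec (k := k) 0
      simp [logCoeff_zero] at this
      simp [logTrunc, matLog_coe, logCoeff_zero, this]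
    rw [h, rAction_smul, zero_smul, zero_add, Finset.sum_range_one, hamiltonian_coe, map_smul,
      LinearMap.smul_apply, traceXPow_zero_bracket, smul_zero]
  | succ K ih =>
    rw [Finset.sum_range_succ, map_add, LinearMap.add_apply, ih, hamiltonian_coe, map_smul,
      LinearMap.smul_apply, bracket_traceXPow, smul_smul, ← rAction_smul, ← rAction_add]
    congr 1
    ext i j : 2
    have h : Γ.logTrunc k (K + 1 + 1) i j =
        Γ.logTrunc k (K + 1) i j + logCoeff k (K + 1) • Γ.xPow k (K + 1) i j := by
      rw [logTrunc, Finset.sum_range_succ, matLog_coe]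
      rfl
    have hr := halfSqLogCoeff_rec (k := k) (K + 1)
    simp only [Pi.add_apply, Pi.sub_apply, Pi.smul_apply]
    rw [h, ← hr]
    push_cast
    module

/-! ### Convergence -/

variable (Γ k) in
/-- The terms of degree at least `D`. -/
def tail (D : ℕ) (i j : Fin N) : Submodule k (Γ.Mor k (Γ.pt i) (Γ.pt j)) :=
  ⨆ d ≥ D, Γ.homog k d i j

theorem homog_le_tail {D d : ℕ} (h : D ≤ d) (i j : Fin N) : Γ.homog k d i j ≤ Γ.tail k D i j :=
  le_iSup₂_of_le d h le_rfl

theorem tail_anti {D D' : ℕ} (h : D ≤ D') (i j : Fin N) : Γ.tail k D' i j ≤ Γ.tail k D i j :=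
  iSup₂_le fun _ hd => homog_le_tail (h.trans hd) i j

theorem conc_mem_tail {D D' : ℕ} {i j l : Fin N} {x : Γ.Mor k (Γ.pt i) (Γ.pt j)}
    {y : Γ.Mor k (Γ.pt j) (Γ.pt l)} (hx : x ∈ Γ.tail k D i j) (hy : y ∈ Γ.tail k D' j l) :
    conc x y ∈ Γ.tail k (D + D') i l := by
  have h : Γ.tail k D i j ≤ (Γ.tail k (D + D') i l).comap (conc.flip y) := by
    refine iSup₂_le fun d hd x hx => ?_
    have h' : Γ.tail k D' j l ≤ (Γ.tail k (D + D') i l).comap (conc x) :=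
      iSup₂_le fun d' hd' y hy => homog_le_tail (add_le_add hd hd') i l (conc_mem hx hy)
    exact h' hy
  exact h hx

/-- The morphism `x` agrees with the power series `f` up to terms of degree at least `D`. -/
def IsApprox (D : ℕ) {i j : Fin N} (x : Γ.Mor k (Γ.pt i) (Γ.pt j)) (f : Γ.Hat k i j) : Prop :=
  x - ∑ d ∈ Finset.range D, (f d : Γ.Mor k (Γ.pt i) (Γ.pt j)) ∈ Γ.tail k D i j

variable {D : ℕ} {i j l : Fin N} {x y : Γ.Mor k (Γ.pt i) (Γ.pt j)} {f g : Γ.Hat k i j}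

theorem isApprox_zero : IsApprox D (0 : Γ.Mor k (Γ.pt i) (Γ.pt j)) 0 := by
  simp [IsApprox]

theorem IsApprox.add (hx : IsApprox D x f) (hy : IsApprox D y g) : IsApprox D (x + y) (f + g) := by
  have := add_mem hx hy
  simp only [IsApprox, Pi.add_apply, Submodule.coe_add, Finset.sum_add_distrib]
  convert! this using 1
  abel

theorem IsApprox.smul (hx : IsApprox D x f) (r : k) : IsApprox D (r • x) (r • f) := by
  have := Submodule.smul_mem _ r hx
  simp only [IsApprox, Pi.smul_apply, Submodule.coe_smul, ← Finset.smul_sum, ← smul_sub]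
  exact this

theorem IsApprox.sum {ι : Type*} {s : Finset ι} {x : ι → Γ.Mor k (Γ.pt i) (Γ.pt j)}
    {f : ι → Γ.Hat k i j} (h : ∀ a ∈ s, IsApprox D (x a) (f a)) :
    IsApprox D (∑ a ∈ s, x a) (∑ a ∈ s, f a) := by
  classical
  induction s using Finset.induction_on with
  | empty => exact isApprox_zero
  | insert a s ha ih =>
    rw [Finset.sum_insert ha, Finset.sum_insert ha]
    exact (h a (by simp)).add (ih fun b hb => h b (by simp [hb]))

theorem IsApprox.add_tail (hx : IsApprox D x f) (hy : y ∈ Γ.tail k D i j) :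
    IsApprox D (x + y) f := by
  rw [IsApprox, add_sub_right_comm]
  exact add_mem hx hy

theorem isApprox_sum_range {K : ℕ} (h : D ≤ K) (f : Γ.Hat k i j) :
    IsApprox D (∑ d ∈ Finset.range K, (f d : Γ.Mor k (Γ.pt i) (Γ.pt j))) f := by
  rw [IsApprox, ← Finset.sum_sdiff (Finset.range_mono h), add_sub_cancel_right]
  refine Submodule.sum_mem _ fun d hd => ?_
  simp only [Finset.mem_sdiff, Finset.mem_range, not_lt] at hd
  exact homog_le_tail hd.2 i j (f d).2

theorem sum_range_mem_tail (K : ℕ) (f : Γ.Hat k i j) :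
    ∑ d ∈ Finset.range K, (f d : Γ.Mor k (Γ.pt i) (Γ.pt j)) ∈ Γ.tail k 0 i j :=
  Submodule.sum_mem _ fun d _ => homog_le_tail (Nat.zero_le d) i j (f d).2

/-- The product of two truncations contains all terms of the Cauchy product of total degree below
`D`; its other terms lie in the tail. -/
theorem isApprox_conc_sum_range (D : ℕ) (f : Γ.Hat k i j) (g : Γ.Hat k j l) :
    IsApprox D (conc (∑ d ∈ Finset.range D, (f d : Γ.Mor k (Γ.pt i) (Γ.pt j)))
      (∑ d ∈ Finset.range D, (g d : Γ.Mor k (Γ.pt j) (Γ.pt l)))) (hatMul f g) := by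
  have h1 : conc (∑ d ∈ Finset.range D, (f d : Γ.Mor k (Γ.pt i) (Γ.pt j)))
      (∑ d ∈ Finset.range D, (g d : Γ.Mor k (Γ.pt j) (Γ.pt l))) = ∑ p ∈ Finset.range D ×ˢ Finset.range D,
      conc (f p.1).1 (g p.2).1 := by
    simp only [map_sum, LinearMap.sum_apply, Finset.sum_product_right]
  have h2 : ∑ d ∈ Finset.range D, (hatMul f g d : Γ.Mor k (Γ.pt i) (Γ.pt l)) =
      ∑ p ∈ (Finset.range D ×ˢ Finset.range D).filter (fun p => p.1 + p.2 < D),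
        conc (f p.1).1 (g p.2).1 := by
    have hmaps : ∀ p ∈ (Finset.range D ×ˢ Finset.range D).filter (fun p => p.1 + p.2 < D),
        p.1 + p.2 ∈ Finset.range D := fun p hp =>
      Finset.mem_range.mpr (Finset.mem_filter.mp hp).2
    refine Eq.trans ?_ (Finset.sum_fiberwise_of_maps_to hmaps _)
    refine Finset.sum_congr rfl fun d hd => ?_
    rw [hatMul_coe]
    refine Finset.sum_congr ?_ fun _ _ => rfl
    ext p
    have := Finset.mem_range.mp hd
    simp only [Finset.HasAntidiagonal.mem_antidiagonal, Finset.mem_filter, Finset.mem_product,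
      Finset.mem_range]
    omega
  rw [IsApprox, h1, h2, ← Finset.sum_filter_add_sum_filter_not _ (fun p => p.1 + p.2 < D),
    add_sub_cancel_left]
  refine Submodule.sum_mem _ fun p hp => ?_
  rw [Finset.mem_filter, not_lt] at hp
  exact homog_le_tail hp.2 i l (conc_mem (f p.1).2 (g p.2).2)

theorem conc_sub_conc_mem_tail {i j l : Fin N} {x F : Γ.Mor k (Γ.pt i) (Γ.pt j)}
    {y G : Γ.Mor k (Γ.pt j) (Γ.pt l)} (hx : x - F ∈ Γ.tail k D i j) (hy : y - G ∈ Γ.tail k D j l)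
    (hF : F ∈ Γ.tail k 0 i j) (hG : G ∈ Γ.tail k 0 j l) :
    conc x y - conc F G ∈ Γ.tail k D i l := by
  have hy0 : y ∈ Γ.tail k 0 j l := by
    have := add_mem (tail_anti (Nat.zero_le D) j l hy) hG
    rwa [sub_add_cancel] at this
  have h1 := conc_mem_tail hx hy0
  have h2 := conc_mem_tail hF hy
  rw [zero_add] at h2
  rw [add_zero, map_sub, LinearMap.sub_apply] at h1
  rw [map_sub] at h2
  -- `xy - FG = (x - F) y + F (y - G)`.
  rw [← sub_add_sub_cancel _ (conc F y)]
  exact add_mem h1 h2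

theorem isApprox_conc {x : Γ.Mor k (Γ.pt i) (Γ.pt j)} {y : Γ.Mor k (Γ.pt j) (Γ.pt l)}
    {f : Γ.Hat k i j} {g : Γ.Hat k j l} (hx : IsApprox D x f) (hy : IsApprox D y g) :
    IsApprox D (conc x y) (hatMul f g) := by
  have h := add_mem (conc_sub_conc_mem_tail hx hy (sum_range_mem_tail D f)
    (sum_range_mem_tail D g)) (isApprox_conc_sum_range D f g)
  rw [sub_add_sub_cancel] at h
  exact h

theorem sum_range_matB {K : ℕ} (hK : 2 ≤ K) (i j : Fin N) :
    ∑ d ∈ Finset.range K, (Γ.matB k i j d : Γ.Mor k (Γ.pt i) (Γ.pt j)) = Γ.bdry k i j := by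
  obtain ⟨K, rfl⟩ := Nat.exists_eq_add_of_le hK
  have h : ∀ d ∈ Finset.range K, (Γ.matB k i j (2 + d) : Γ.Mor k (Γ.pt i) (Γ.pt j)) = 0 := by
    intro d _
    rw [matB, dif_neg (by omega), dif_neg (by omega)]
    rfl
  rw [Finset.sum_range_add, Finset.sum_eq_zero h]
  simp [matB, Finset.sum_range_succ, bdry_eq]

theorem isApprox_bdry (D : ℕ) (i j : Fin N) : IsApprox D (Γ.bdry k i j) (Γ.matB k i j) := by
  rw [← sum_range_matB (le_max_right D 2)]
  exact isApprox_sum_range (le_max_left D 2) _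

theorem xPow_mem (n : ℕ) (i j : Fin N) : Γ.xPow k n i j ∈ Γ.homog k n i j := by
  have h := (matPow (Γ.matB k - Γ.matOne k) n i j n).2
  rwa [matPow_coe, if_pos rfl] at h

/-- For `G = log B`, the first sum of `rAction` is `MB`. In the second the sign has the column index
subtracted from the row index, opposite to the first, so it is `-BM`. -/
theorem isApprox_rAction {G : ∀ i j : Fin N, Γ.Mor k (Γ.pt i) (Γ.pt j)}
    (hG : ∀ i j, IsApprox D (G i j) (matLog (Γ.matB k) i j)) (i j : Fin N) :
    IsApprox D (rAction G i j)
      ((matMul (Γ.matM k) (Γ.matB k) - matMul (Γ.matB k) (Γ.matM k)) i j) := by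
  rw [Pi.sub_apply, Pi.sub_apply, sub_eq_add_neg]
  refine IsApprox.add (IsApprox.sum fun u _ => isApprox_conc ?_ (isApprox_bdry D u j)) ?_
  · have h : Γ.matM k i u = (1 / 2 * sgn k u i) • matLog (Γ.matB k) i u := by
      rw [matM, sgn]
      split_ifs <;> simp
    rw [h]
    exact (hG i u).smul _
  · have h : -matMul (Γ.matB k) (Γ.matM k) i j =
        ∑ v, hatMul (Γ.matB k i v) ((1 / 2 * sgn k v j) • matLog (Γ.matB k) v j) := by
      rw [matMul, ← Finset.sum_neg_distrib]
      refine Finset.sum_congr rfl fun v _ => ?_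
      have h : (1 / 2 * sgn k v j) • matLog (Γ.matB k) v j = -Γ.matM k v j := by
        rw [matM, sgn]
        split_ifs with h1 h2
        · exact absurd h1 (lt_asymm h2)
        · simp
        · simp
        · simp
      rw [h]
      funext m
      refine Subtype.ext ?_
      simp only [Pi.neg_apply, Submodule.coe_neg, hatMul_coe, map_neg, Finset.sum_neg_distrib]
    rw [h]
    exact IsApprox.sum fun v _ => isApprox_conc (isApprox_bdry D i v) ((hG v j).smul _)

theorem isBracket_hamiltonian [CharZero k] (i j : Fin N) :
    IsBracket (Γ.hamiltonian k) (Γ.matB k i j)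
      ((matMul (Γ.matM k) (Γ.matB k) - matMul (Γ.matB k) (Γ.matM k)) i j) := by
  intro D
  -- `K ≥ 2` makes the truncation of `B` exact, and `K - 1 ≥ D` puts the error term, a multiple of
  -- `X^(K-1)`, into the tail.
  refine ⟨D + 2, fun K hK => ?_⟩
  obtain ⟨K, rfl⟩ : ∃ K', K = K' + 1 := ⟨K - 1, by omega⟩
  rw [sum_range_matB (by omega), bracket_sum_hamiltonian]
  refine isApprox_rAction (fun i j => ?_) i j
  rw [Pi.sub_apply, Pi.sub_apply, sub_eq_add_neg]
  refine (isApprox_sum_range (by omega) _).add_tail (neg_mem ?_)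
  exact Submodule.smul_mem _ _ (homog_le_tail (by omega) i j (xPow_mem K i j))

end

end DiskNetwork

namespace DiskNetwork

/-! ### Independence of the homogeneous components -/

noncomputable section

variable {N : ℕ} {Γ : DiskNetwork N} {k : Type*} [Field k]

/-- The list of edges of a path. -/
def word {a : Γ.Glued} : ∀ {b : Γ.Glued}, Quiver.Path a b → List Γ.E
  | _, .nil => []
  | _, .cons p e => word p ++ [e.1]

theorem word_comp {a b c : Γ.Glued} (p : Quiver.Path a b) (q : Quiver.Path b c) :
    word (p.comp q) = word p ++ word q := by
  induction q with
  | nil => simp [word]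
  | cons q e ih => rw [Quiver.Path.comp_cons, word, ih, word, List.append_assoc]

theorem word_injective (a b : Γ.Glued) :
    Function.Injective (word : Quiver.Path a b → List Γ.E) := by
  intro p
  induction p with
  | nil =>
    intro q h
    have key : ∀ {b} (q : Quiver.Path a b), word q = [] → q.length = 0 := by
      intro b q h
      cases q with
      | nil => rfl
      | cons q e => simp [word] at h
    exact (Quiver.Path.eq_nil_of_length_zero q (key q h.symm)).symm
  | cons p e ih =>
    intro q h
    cases q with
    | nil => simp [word] at h
    | cons q e' =>
      obtain ⟨h1, h2⟩ := List.append_inj' h rfl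
      obtain ⟨e, rfl, he⟩ := e
      obtain ⟨e', rfl, he'⟩ := e'
      obtain rfl : e = e' := by simpa using h2
      rw [ih h1]

theorem sourceEdge_injective : Function.Injective Γ.sourceEdge := fun i j h => by
  have := (Γ.src_eq_source_iff (Γ.sourceEdge i) j).mpr h
  rw [src_sourceEdge] at this
  exact NetVertex.source.inj this

theorem sinkEdge_injective : Function.Injective Γ.sinkEdge := fun i j h => by
  have := (Γ.tgt_eq_sink_iff (Γ.sinkEdge i) j).mpr h
  rw [tgt_sinkEdge] at this
  exact NetVertex.sink.inj this

/-- In the word of a path of the network, a source edge occurs only at the first place. Source edges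
therefore mark where a path of the glued graph passes from one network path to the next. -/
theorem word_mapPath_source {i : Fin N} {b : Γ.Vertex} (p : Quiver.Path (Γ.source i) b) :
    (b = Γ.source i ∧ word (Γ.glue.mapPath p) = []) ∨ ((∀ l, b ≠ Γ.source l) ∧
      ∃ r, word (Γ.glue.mapPath p) = Γ.sourceEdge i :: r ∧ ∀ e ∈ r, ∀ l, e ≠ Γ.sourceEdge l) := by
  induction p with
  | nil => exact Or.inl ⟨rfl, rfl⟩
  | cons p e ih =>
    refine Or.inr ⟨fun l h => Γ.tgt_ne_source e.1 l (e.2.2.trans h), ?_⟩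
    rw [Prefunctor.mapPath_cons, word]
    obtain ⟨hb, h⟩ | ⟨hb, r, h, hr⟩ := ih
    · have he : e.1 = Γ.sourceEdge i := (Γ.src_eq_source_iff e.1 i).mp (e.2.1.trans hb)
      refine ⟨[], ?_, by simp⟩
      rw [h, ← he]
      rfl
    · refine ⟨r ++ [e.1], ?_, ?_⟩
      · rw [h]
        rfl
      · intro e' he' l hl
        rw [List.mem_append, List.mem_singleton] at he'
        obtain he' | rfl := he'
        · exact hr e' he' l hl
        · exact hb l (e.2.1.symm.trans ((Γ.src_eq_source_iff e.1 l).mpr hl))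

theorem word_mapPath {i j : Fin N} (p : Quiver.Path (Γ.source i) (Γ.sink j)) :
    ∃ r, word (Γ.glue.mapPath p) = Γ.sourceEdge i :: r ∧ ∀ e ∈ r, ∀ l, e ≠ Γ.sourceEdge l := by
  obtain ⟨h, -⟩ | ⟨-, h⟩ := word_mapPath_source p
  · exact absurd h.symm (Γ.source_ne_sink i j)
  · exact h

theorem word_mapPath_sink {i j : Fin N} (p : Quiver.Path (Γ.source i) (Γ.sink j)) :
    ∃ r, word (Γ.glue.mapPath p) = r ++ [Γ.sinkEdge j] := by
  have key : ∀ {b : Γ.Vertex} (p : Quiver.Path (Γ.source i) b), b = Γ.sink j →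
      ∃ r, word (Γ.glue.mapPath p) = r ++ [Γ.sinkEdge j] := by
    intro b p hb
    cases p with
    | nil => exact absurd hb (Γ.source_ne_sink i j)
    | cons p e =>
      have he : e.1 = Γ.sinkEdge j := (Γ.tgt_eq_sink_iff e.1 j).mp (e.2.2.trans hb)
      exact ⟨_, by rw [Prefunctor.mapPath_cons, word, ← he]; rfl⟩
  exact key p rfl

theorem word_mapPath_inj {i j i' j' : Fin N} {p : Quiver.Path (Γ.source i) (Γ.sink j)}
    {p' : Quiver.Path (Γ.source i') (Γ.sink j')}
    (h : word (Γ.glue.mapPath p) = word (Γ.glue.mapPath p')) : i = i' ∧ j = j' := by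
  obtain ⟨r, hr, -⟩ := word_mapPath p
  obtain ⟨r', hr', -⟩ := word_mapPath p'
  obtain ⟨t, ht⟩ := word_mapPath_sink p
  obtain ⟨t', ht'⟩ := word_mapPath_sink p'
  refine ⟨sourceEdge_injective (List.cons.inj (hr.symm.trans (h.trans hr'))).1,
    sinkEdge_injective (Γ := Γ) ?_⟩
  simpa using (List.append_inj' (ht.symm.trans (h.trans ht')) rfl).2

theorem mapPath_injective (a b : Γ.Vertex) :
    Function.Injective (Γ.glue.mapPath : Quiver.Path a b → _) := by
  intro p
  induction p with
  | nil =>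
    intro q h
    have key : ∀ {b} (q : Quiver.Path a b), (Γ.glue.mapPath q).length = 0 → q.length = 0 := by
      intro b q h
      cases q with
      | nil => rfl
      | cons q e => simp at h
    exact (Quiver.Path.eq_nil_of_length_zero q (key q (by rw [← h]; rfl))).symm
  | @cons b c p e ih =>
    intro q h
    have key : ∀ {c' : Γ.Vertex} (q : Quiver.Path a c') (hc : c' = c),
        word (Γ.glue.mapPath (p.cons e)) = word (Γ.glue.mapPath q) → hc ▸ q = p.cons e := by
      intro c' q hc h
      cases q with
      | nil => simp [word] at h
      | cons q e' =>
        subst hc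
        obtain ⟨h1, h2⟩ := List.append_inj' h rfl
        obtain ⟨e, rfl, he⟩ := e
        obtain ⟨e', rfl, he'⟩ := e'
        obtain rfl : e = e' := List.singleton_inj.mp h2
        rw [ih (word_injective _ _ h1)]
    exact (key q rfl (congrArg word h)).symm

/-! ### Words in the edges and their decomposition into blocks -/

variable (Γ k) in
/-- The free algebra on the edges. -/
abbrev WordAlgebra : Type _ := MonoidAlgebra k (FreeMonoid Γ.E)

variable (k) in
/-- A word, as an element of the free algebra. -/
def ofWord (w : List Γ.E) : Γ.WordAlgebra k := MonoidAlgebra.of k _ (FreeMonoid.ofList w)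

theorem ofWord_append (w w' : List Γ.E) : ofWord k (w ++ w') = ofWord k w * ofWord k w' :=
  map_mul (MonoidAlgebra.of k (FreeMonoid Γ.E)) (FreeMonoid.ofList w) (FreeMonoid.ofList w')

theorem ofWord_nil : ofWord k ([] : List Γ.E) = 1 := map_one (MonoidAlgebra.of k (FreeMonoid Γ.E))

/-- The embedding of morphisms into the free algebra on the edges. -/
def toWords {a b : Γ.Glued} : Γ.Mor k a b →ₗ[k] Γ.WordAlgebra k :=
  extend fun p => ofWord k (word p)

theorem toWords_ofPath {a b : Γ.Glued} (p : Quiver.Path a b) :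
    toWords (ofPath p : Γ.Mor k a b) = ofWord k (word p) := extend_ofPath _ p

theorem toWords_conc {a b c : Γ.Glued} (f : Γ.Mor k a b) (g : Γ.Mor k b c) :
    toWords (conc f g) = toWords f * toWords g := by
  induction f using mor_induction with
  | zero => simp
  | add f f' hf hf' => simp only [map_add, LinearMap.add_apply, hf, hf', add_mul]
  | smul r f hf => simp only [map_smul, LinearMap.smul_apply, hf, smul_mul_assoc]
  | path p =>
    induction g using mor_induction with
    | zero => simp
    | add f f' hf hf' => simp only [map_add, hf, hf', mul_add]
    | smul r f hf => simp only [map_smul, hf, mul_smul_comm]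
    | path q => rw [← ofPath_comp, toWords_ofPath, toWords_ofPath, toWords_ofPath, word_comp,
        ofWord_append]

theorem toWords_injective (a b : Γ.Glued) :
    Function.Injective (toWords : Γ.Mor k a b → Γ.WordAlgebra k) := by
  have h := (MonoidAlgebra.basis (FreeMonoid Γ.E) k).linearIndependent.comp
    (fun p : Quiver.Path a b => FreeMonoid.ofList (word p))
    (FreeMonoid.ofList.injective.comp (word_injective a b))
  have heq : (fun p : Quiver.Path a b => ofWord k (word p)) =
      (MonoidAlgebra.basis (FreeMonoid Γ.E) k) ∘ fun p => FreeMonoid.ofList (word p) := by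
    funext p
    simp [ofWord]
  intro x y hxy
  unfold toWords extend at hxy
  rw [heq] at hxy
  exact h hxy

open Classical in
/-- Cut a word before every source edge, and apply a function to the pieces which start with a
source edge: the remaining initial piece, and the product of the values. -/
def scan {A : Type*} [Monoid A] (φ : List Γ.E → A) : List Γ.E → List Γ.E × A
  | [] => ([], 1)
  | e :: w => if ∃ i, e = Γ.sourceEdge i then ([], φ (e :: (scan φ w).1) * (scan φ w).2)
      else (e :: (scan φ w).1, (scan φ w).2)

/-- The hypothesis says that nothing of `w'` precedes its first source edge, so no block straddles
the junction. -/
theorem scan_append {A : Type*} [Monoid A] (φ : List Γ.E → A) (w w' : List Γ.E)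
    (h : (scan φ w').1 = []) : scan φ (w ++ w') = ((scan φ w).1, (scan φ w).2 * (scan φ w').2) := by
  induction w with
  | nil => exact Prod.ext h (one_mul _).symm
  | cons e w ih =>
    rw [List.cons_append, scan, ih, scan]
    split_ifs
    · rw [mul_assoc]
    · rfl

theorem scan_of_forall {A : Type*} [Monoid A] (φ : List Γ.E → A) (w : List Γ.E)
    (h : ∀ e ∈ w, ∀ l, e ≠ Γ.sourceEdge l) : scan φ w = (w, 1) := by
  induction w with
  | nil => rfl
  | cons e w ih =>
    rw [scan, if_neg, ih fun e he => h e (List.mem_cons_of_mem _ he)]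
    rintro ⟨l, hl⟩
    exact h e List.mem_cons_self l hl

theorem scan_word_mapPath {A : Type*} [Monoid A] (φ : List Γ.E → A) {i j : Fin N}
    (p : Quiver.Path (Γ.source i) (Γ.sink j)) :
    scan φ (word (Γ.glue.mapPath p)) = ([], φ (word (Γ.glue.mapPath p))) := by
  obtain ⟨r, h, hr⟩ := word_mapPath p
  rw [h, scan, if_pos ⟨i, rfl⟩, scan_of_forall φ r hr, mul_one]

/-! ### An operator scaling the entries of `X` by two -/

section Grading

variable (P : ∀ i : Fin N, Quiver.Path (Γ.source i) (Γ.sink i))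

open Classical in
variable (k) in
/-- Twice a word, minus one for the chosen path from the `i`-th source to the `i`-th sink. -/
def gradingBlock (w : List Γ.E) : Γ.WordAlgebra k :=
  (2 : k) • ofWord k w - if ∃ i, w = word (Γ.glue.mapPath (P i)) then 1 else 0

variable (k) in
/-- A linear endomorphism of the free algebra which multiplies the homogeneous component of degree
`m` by `2ᵐ`. -/
def grading : Γ.WordAlgebra k →ₗ[k] Γ.WordAlgebra k :=
  (MonoidAlgebra.basis (FreeMonoid Γ.E) k).constr k fun w =>
    ofWord k (scan (gradingBlock k P) w.toList).1 * (scan (gradingBlock k P) w.toList).2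

theorem grading_ofWord (w : List Γ.E) : grading k P (ofWord k w) =
    ofWord k (scan (gradingBlock k P) w).1 * (scan (gradingBlock k P) w).2 := by
  have h : ofWord k w = MonoidAlgebra.basis (FreeMonoid Γ.E) k (FreeMonoid.ofList w) := by
    simp [ofWord]
  rw [h, grading, Module.Basis.constr_basis]
  rfl

/-- The operator is multiplicative only for right factors made of whole blocks. This suffices
because monomials grow by one entry of `X` on the right. -/
theorem grading_mul_ofWord (x : Γ.WordAlgebra k) (w : List Γ.E)
    (hw : (scan (gradingBlock k P) w).1 = []) :
    grading k P (x * ofWord k w) = grading k P x * grading k P (ofWord k w) := by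
  have h : grading k P ∘ₗ LinearMap.mulRight k (ofWord k w) =
      LinearMap.mulRight k (grading k P (ofWord k w)) ∘ₗ grading k P := by
    refine (MonoidAlgebra.basis (FreeMonoid Γ.E) k).ext fun u => ?_
    have h : MonoidAlgebra.basis (FreeMonoid Γ.E) k u = ofWord k u.toList := by
      simp [ofWord]
    rw [h, LinearMap.comp_apply, LinearMap.comp_apply, LinearMap.mulRight_apply,
      LinearMap.mulRight_apply, ← ofWord_append, grading_ofWord, grading_ofWord, grading_ofWord,
      scan_append _ _ _ hw, hw, ofWord_nil, one_mul, mul_assoc]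
  exact LinearMap.congr_fun h x

theorem grading_ofWord_word (i j : Fin N) (p : Quiver.Path (Γ.source i) (Γ.sink j)) :
    grading k P (ofWord k (word (Γ.glue.mapPath p))) =
      gradingBlock k P (word (Γ.glue.mapPath p)) := by
  rw [grading_ofWord, scan_word_mapPath, ofWord_nil, one_mul]

theorem toWords_bdry (i j : Fin N) : toWords (Γ.bdry k i j) =
    ∑ p : Quiver.Path (Γ.source i) (Γ.sink j), ofWord k (word (Γ.glue.mapPath p)) :=
  (map_sum _ _ _).trans (Finset.sum_congr rfl fun _ _ => toWords_ofPath _)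

theorem toWords_unit (i j : Fin N) :
    toWords (Γ.unit k i j) = if i = j then (1 : Γ.WordAlgebra k) else 0 := by
  split_ifs with h
  · subst h
    rw [unit_self, toWords_ofPath, word, ofWord_nil]
  · rw [unit_of_ne h, map_zero]

theorem grading_one : grading k P 1 = 1 := by
  rw [← ofWord_nil, grading_ofWord, scan, ofWord_nil, one_mul]

/-- Exactly one distinguished path occurs in `b_ii`, and none in `b_ij` for `i ≠ j`. Thus `b_ij`
goes to `2 b_ij - δ_ij`, and since constants are fixed, `b_ij - δ_ij` goes to twice itself. -/
theorem grading_mul_shifted (x : Γ.WordAlgebra k) (i j : Fin N) :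
    grading k P (x * toWords (Γ.shifted k i j)) =
      (2 : k) • (grading k P x * toWords (Γ.shifted k i j)) := by
  classical
  -- The number of distinguished paths from source `i` to sink `j` is `δ_ij`, as the word of a path
  -- determines both of its end points.
  have hcount : ∑ p : Quiver.Path (Γ.source i) (Γ.sink j),
      (if ∃ l, word (Γ.glue.mapPath p) = word (Γ.glue.mapPath (P l)) then
        (1 : Γ.WordAlgebra k) else 0) = if i = j then 1 else 0 := by
    split_ifs with h
    · subst h
      rw [Finset.sum_eq_single (P i), if_pos ⟨i, rfl⟩]
      · rintro p - hp
        rw [if_neg]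
        rintro ⟨l, hl⟩
        obtain ⟨rfl, -⟩ := word_mapPath_inj hl
        exact hp (mapPath_injective _ _ (word_injective _ _ hl))
      · simp
    · refine Finset.sum_eq_zero fun p _ => ?_
      rw [if_neg]
      rintro ⟨l, hl⟩
      obtain ⟨rfl, rfl⟩ := word_mapPath_inj hl
      exact h rfl
  have hb : grading k P (x * toWords (Γ.bdry k i j)) = grading k P x *
      ((2 : k) • toWords (Γ.bdry k i j) - if i = j then (1 : Γ.WordAlgebra k) else 0) := by
    rw [toWords_bdry, Finset.mul_sum, map_sum, Finset.smul_sum, ← hcount, ← Finset.sum_sub_distrib,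
      Finset.mul_sum]
    refine Finset.sum_congr rfl fun p _ => ?_
    rw [grading_mul_ofWord P x _ (by rw [scan_word_mapPath]), grading_ofWord_word, gradingBlock]
  have hu : grading k P (x * if i = j then (1 : Γ.WordAlgebra k) else 0) =
      grading k P x * if i = j then (1 : Γ.WordAlgebra k) else 0 := by
    split_ifs <;> simp
  rw [shifted, map_sub, toWords_unit, mul_sub, map_sub, hb, hu, ← mul_sub, ← mul_smul_comm]
  congr 1
  rw [smul_sub, two_smul k (if i = j then (1 : Γ.WordAlgebra k) else 0)]
  abel

theorem grading_toWords {m : ℕ} {i j : Fin N} {f : Γ.Mor k (Γ.pt i) (Γ.pt j)}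
    (hf : f ∈ Γ.homog k m i j) : grading k P (toWords f) = (2 : k) ^ m • toWords f := by
  induction hf using Submodule.span_induction with
  | zero => simp
  | add x y _ _ hx hy => simp only [map_add, hx, hy, smul_add]
  | smul r x _ hx => rw [map_smul, map_smul, hx, smul_comm]
  | mem f hf =>
    clear * - hf
    induction hf with
    | one i => rw [toWords_unit, if_pos rfl, grading_one, pow_zero, one_smul]
    | mul hf j ih =>
      rw [toWords_conc, grading_mul_shifted, ih, smul_mul_assoc, smul_smul, pow_succ']

end Grading

/-- The sum of the homogeneous components is direct. -/
theorem eq_zero_of_mem_homog_of_mem_tail [CharZero k]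
    (hdiag : ∀ i : Fin N, Nonempty (Quiver.Path (Γ.source i) (Γ.sink i))) {d : ℕ} {i j : Fin N}
    {x : Γ.Mor k (Γ.pt i) (Γ.pt j)} (h : x ∈ Γ.homog k d i j) (h' : x ∈ Γ.tail k (d + 1) i j) :
    x = 0 := by
  let P : ∀ i : Fin N, Quiver.Path (Γ.source i) (Γ.sink i) := fun i => (hdiag i).some
  have hmem : ∀ {m : ℕ} {f : Γ.Mor k (Γ.pt i) (Γ.pt j)}, f ∈ Γ.homog k m i j →
      toWords f ∈ Module.End.eigenspace (grading k P) ((2 : k) ^ m) := fun hf =>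
    Module.End.mem_eigenspace_iff.mpr (grading_toWords P hf)
  have htail : Γ.tail k (d + 1) i j ≤
      (⨆ (μ : k) (_ : μ ≠ 2 ^ d), Module.End.eigenspace (grading k P) μ).comap toWords := by
    refine iSup₂_le fun m hm f hf => ?_
    -- Characteristic zero keeps the eigenvalues of different degrees distinct.
    have hne : (2 : k) ^ m ≠ 2 ^ d := by
      have : 2 ^ m ≠ 2 ^ d := (Nat.pow_right_injective le_rfl).ne (by omega)
      exact_mod_cast this
    exact le_iSup₂_of_le (f := fun (μ : k) (_ : μ ≠ 2 ^ d) =>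
      Module.End.eigenspace (grading k P) μ) _ hne le_rfl (hmem hf)
  have h0 := (Submodule.disjoint_def.mp
    (Module.End.eigenspaces_iSupIndep (grading k P) ((2 : k) ^ d))) _ (hmem h) (htail h')
  exact toWords_injective _ _ (h0.trans (map_zero _).symm)

theorem IsBracket.unique [CharZero k]
    (hdiag : ∀ i : Fin N, Nonempty (Quiver.Path (Γ.source i) (Γ.sink i))) {i j : Fin N}
    {h : Γ.CycHat k} {c f f' : Γ.Hat k i j} (hf : IsBracket h c f) (hf' : IsBracket h c f') :
    f = f' := by
  -- Both series approximate the same bracket of truncations, for `K` beyond both thresholds. With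
  -- `D = d + 1` and equality in lower degrees, the difference in degree `d` lies in the tail from
  -- `d + 1` on, hence vanishes.
  have hD : ∀ D : ℕ, ∑ d ∈ Finset.range D, ((f d).1 - (f' d).1) ∈ Γ.tail k D i j := by
    intro D
    obtain ⟨K, hK⟩ := hf D
    obtain ⟨K', hK'⟩ := hf' D
    have := sub_mem (hK' (max K K') (le_max_right _ _)) (hK (max K K') (le_max_left _ _))
    rw [sub_sub_sub_cancel_left, ← Finset.sum_sub_distrib] at this
    exact this
  funext d
  induction d using Nat.strong_induction_on with
  | _ d ih =>
    have hd := hD (d + 1)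
    rw [Finset.sum_range_succ, Finset.sum_eq_zero, zero_add] at hd
    · exact Subtype.ext (sub_eq_zero.mp
        (eq_zero_of_mem_homog_of_mem_tail hdiag (sub_mem (f d).2 (f' d).2) hd))
    · intro e he
      rw [ih e (Finset.mem_range.mp he), sub_self]

end

end DiskNetwork

theorem mainTheorem7 {k : Type*} [Field k] [CharZero k] {N : ℕ} (Γ : DiskNetwork N)
    (hdiag : ∀ i : Fin N, Nonempty (Quiver.Path (Γ.source i) (Γ.sink i)))
    (i j : Fin N) (f : Γ.Hat k i j) :
    DiskNetwork.IsBracket (Γ.hamiltonian k) (Γ.matB k i j) f ↔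
      f = (DiskNetwork.matMul (Γ.matM k) (Γ.matB k) -
        DiskNetwork.matMul (Γ.matB k) (Γ.matM k)) i j := by
  refine ⟨fun h => h.unique hdiag (DiskNetwork.isBracket_hamiltonian i j), ?_⟩
  rintro rfl
  exact DiskNetwork.isBracket_hamiltonian i j
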